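/- Let $K$ be a field. **Posets.** A double poset is a finite set with two partial orders $\leq_h,\leq_r$. It is plane if any two distinct elements are comparable for exactly one of the two orders. It is WN if it is plane and has no double subposet isomorphic to one of the two plane posets on $\{a,b,c,d\}$ whose strict relations are $a<_hc,\ a<_hd,\ b<_hd,\ a<_rb,\ c<_rb,\ c<_rd$, respectively $a<_hc,\ b<_hc,\ b<_hd,\ a<_rb,\ a<_rd,\ c<_rd$. It is $h$-connected if it is nonempty and any two elements are joined by a path of $\leq_h$-comparable elements. Let $H_{WNP}$ be the vector space with basis the isomorphism classes of WN posets. For WN posets $P,Q$, let $PQ$ be the disjoint union of $P$ and $Q$ (with their orders), where $x\leq_r y$ and $x,y$ are not $\leq_h$-comparable for all $x\in P$, $y\in Q$; let $$P\star Q=\sum_{R} n(P,Q;R)\,R,\qquad \Delta(P)=\sum_{QR=P}Q\otimes R,$$ where $R$ in the first sum runs over WN posets and $n(P,Q;R)$ is the number of subsets $I\subseteq R$, closed upwards for $\leq_h$, with $R\setminus I\cong P$ and $I\cong Q$, and the second sum runs over the pairs of isomorphism classes $(Q,R)$ with $QR=P$. Extend these linearly; the unit $1$ is the empty poset. Let $\mathrm{Prim}(H_{WNP})=\{x\in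 H_{WNP} : \Delta(x)=x\otimes 1+1\otimes x\}$. **$B_\infty$-algebras.** For a vector space $V$, let $T(V)$ be the tensor coalgebra with the deconcatenation coproduct, and $\pi_V:T(V)\to V$ the canonical projection. A $B_\infty$-algebra is a vector space $V$ with linear maps $[-;-]_{m,n}:V^{\otimes m}\otimes V^{\otimes n}\to V$ $(m,n\geq 1)$ such that there is a coalgebra morphism $\star_V:T(V)\otimes T(V)\to T(V)$ with $\pi_V\big((x_1\cdots x_m)\star_V(y_1\cdots y_n)\big)=[x_1,\dots,x_m;y_1,\dots,y_n]_{m,n}$ for all $m,n\geq 1$ which makes $T(V)$ a Hopf algebra with unit the empty word. A morphism of $B_\infty$-algebras is a linear map that commutes with all the maps $[-;-]_{m,n}$. **Theorem.** 1. $\mathrm{Prim}(H_{WNP})$ is the span of the $h$-connected WN posets. 2. Let $\pi:H_{WNP}\to \mathrm{Prim}(H_{WNP})$ be the linear projection that fixes the $h$-connected WN posets and kills the other ones. Then the maps $$[P_1,\dots,P_m;Q_1,\dots,Q_n]_{m,n}=\pi\big((P_1\cdots P_m)\star(Q_1\cdots Q_n)\big)\qquad (m,n\geq 1)$$ make $\mathrm{Prim}(H_{WNP})$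 a $B_\infty$-algebra. 3. It is the free $B_\infty$-algebra on the one-point poset $\bullet$: for any $B_\infty$-algebra $B$ over $K$ and any $x\in B$, there is a unique morphism of $B_\infty$-algebras $\phi:\mathrm{Prim}(H_{WNP})\to B$ with $\phi(\bullet)=x$. -/

import Mathlib

open scoped TensorProduct

namespace BInf

/-! ### The tensor coalgebra -/

/-- Auxiliary operator for the deconcatenation coproduct: the vector `v` acts on pairs `(t, w)`
by `v · (t, w) = ((v ⊗ 1) t + 1 ⊗ v w, v w)`. -/
noncomputable def deconcAux (K V : Type*) [Field K] [AddCommGroup V] [Module K V] :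
    V →ₗ[K] Module.End K
      ((TensorAlgebra K V ⊗[K] TensorAlgebra K V) × TensorAlgebra K V) :=
  LinearMap.mk₂ K
    (fun v p => ((TensorAlgebra.ι K v ⊗ₜ[K] 1) * p.1 + 1 ⊗ₜ[K] (TensorAlgebra.ι K v * p.2),
      TensorAlgebra.ι K v * p.2))
    (fun v v' p => by
      simp only [map_add, TensorProduct.add_tmul, TensorProduct.tmul_add, add_mul, Prod.mk_add_mk]
      abel_nf)
    (fun c v p => by
      simp only [map_smul, Prod.smul_mk, smul_add, smul_mul_assoc, TensorProduct.tmul_smul,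
        ← TensorProduct.smul_tmul'])
    (fun v p q => by
      simp only [Prod.fst_add, Prod.snd_add, mul_add, TensorProduct.tmul_add, Prod.mk_add_mk]
      abel_nf)
    (fun c v p => by
      simp only [Prod.smul_fst, Prod.smul_snd, mul_smul_comm, TensorProduct.tmul_smul,
        Prod.smul_mk, smul_add])

theorem deconcAux_apply {K V : Type*} [Field K] [AddCommGroup V] [Module K V] (v : V)
    (p : (TensorAlgebra K V ⊗[K] TensorAlgebra K V) × TensorAlgebra K V) :
    deconcAux K V v p =
      ((TensorAlgebra.ι K v ⊗ₜ[K] 1) * p.1 + 1 ⊗ₜ[K] (TensorAlgebra.ι K v * p.2),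
        TensorAlgebra.ι K v * p.2) := rfl

/-- The deconcatenation coproduct of `T(V)`; see `deconc_word` for the usual formula
`Δ(v₁ ⋯ vₙ) = ∑ᵢ v₁ ⋯ vᵢ ⊗ vᵢ₊₁ ⋯ vₙ`. -/
noncomputable def deconc (K V : Type*) [Field K] [AddCommGroup V] [Module K V] :
    TensorAlgebra K V →ₗ[K] TensorAlgebra K V ⊗[K] TensorAlgebra K V :=
  LinearMap.fst K _ _ ∘ₗ LinearMap.applyₗ (1, 1) ∘ₗ
    (TensorAlgebra.lift K (deconcAux K V)).toLinearMap

theorem lift_deconcAux_snd {K V : Type*} [Field K] [AddCommGroup V] [Module K V]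
    (w : TensorAlgebra K V) :
    ∀ p, (TensorAlgebra.lift K (deconcAux K V) w p).2 = w * p.2 := by
  induction w using TensorAlgebra.induction with
  | algebraMap r => intro p; simp [Algebra.smul_def]
  | ι x => intro p; simp [deconcAux_apply]
  | mul a b ha hb => intro p; simp [ha, hb, mul_assoc]
  | add a b ha hb => intro p; simp [ha, hb, add_mul]

theorem deconc_one (K V : Type*) [Field K] [AddCommGroup V] [Module K V] :
    deconc K V 1 = 1 ⊗ₜ 1 := by
  simp [deconc, Algebra.TensorProduct.one_def]

theorem deconc_ι_mul {K V : Type*} [Field K] [AddCommGroup V] [Module K V]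
    (v : V) (w : TensorAlgebra K V) :
    deconc K V (TensorAlgebra.ι K v * w) =
      (TensorAlgebra.ι K v ⊗ₜ 1) * deconc K V w + 1 ⊗ₜ (TensorAlgebra.ι K v * w) := by
  have h := lift_deconcAux_snd w ((1, 1) : _ × TensorAlgebra K V)
  simp only [mul_one] at h
  simp only [deconc, LinearMap.comp_apply, AlgHom.toLinearMap_apply, map_mul,
    TensorAlgebra.lift_ι_apply, LinearMap.applyₗ_apply_apply, Module.End.mul_apply,
    LinearMap.fst_apply]
  simp [deconcAux_apply, h]

/-- Deconcatenation of words. -/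
theorem deconc_word {K V : Type*} [Field K] [AddCommGroup V] [Module K V] (l : List V) :
    deconc K V (l.map (TensorAlgebra.ι K)).prod =
      ∑ i ∈ Finset.range (l.length + 1),
        ((l.take i).map (TensorAlgebra.ι K)).prod ⊗ₜ[K]
          ((l.drop i).map (TensorAlgebra.ι K)).prod := by
  induction l with
  | nil => simp [deconc_one]
  | cons v l ih =>
    rw [List.map_cons, List.prod_cons, deconc_ι_mul, ih, Finset.mul_sum, List.length_cons,
      Finset.sum_range_succ' _ (l.length + 1)]
    simp

/-- Linear maps on `T(V)` can be compared letter by letter. -/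
theorem tensorAlgebra_left_induction {K V : Type*} [Field K] [AddCommGroup V] [Module K V]
    {C : TensorAlgebra K V → Prop} (one : C 1)
    (cons : ∀ v w, C w → C (TensorAlgebra.ι K v * w))
    (add : ∀ a b, C a → C b → C (a + b)) (smul : ∀ (r : K) a, C a → C (r • a))
    (a : TensorAlgebra K V) : C a := by
  have key : ∀ b, C b → C (a * b) := by
    induction a using TensorAlgebra.induction with
    | algebraMap r => intro b hb; rw [← Algebra.smul_def]; exact smul r b hb
    | ι x => intro b hb; exact cons x b hb
    | mul a b ha hb => intro c hc; rw [mul_assoc]; exact ha _ (hb _ hc)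
    | add a b ha hb => intro c hc; rw [add_mul]; exact add _ _ (ha _ hc) (hb _ hc)
  simpa using key 1 one

/-- The tensor coalgebra: `T(V)` with the deconcatenation coproduct and the counit that is the
projection on the degree zero part. -/
noncomputable instance tensorCoalgebra (K V : Type*) [Field K] [AddCommGroup V] [Module K V] :
    Coalgebra K (TensorAlgebra K V) where
  comul := deconc K V
  counit := TensorAlgebra.algebraMapInv.toLinearMap
  coassoc := by
    ext a
    simp only [LinearMap.comp_apply, LinearEquiv.coe_coe]
    induction a using tensorAlgebra_left_induction with
    | one => simp [deconc_one]
    | add a b ha hb => simp only [map_add, ha, hb]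
    | smul r a ha => simp only [map_smul, ha]
    | cons v w ih =>
      have h1 : ∀ t : TensorAlgebra K V ⊗[K] TensorAlgebra K V,
          TensorProduct.assoc K _ _ _ ((deconc K V).rTensor _ ((TensorAlgebra.ι K v ⊗ₜ 1) * t)) =
            (TensorAlgebra.ι K v ⊗ₜ 1) *
              TensorProduct.assoc K _ _ _ ((deconc K V).rTensor _ t) +
            1 ⊗ₜ ((TensorAlgebra.ι K v ⊗ₜ 1) * t) := by
        intro t
        induction t with
        | zero => simp
        | add x y hx hy => simp only [mul_add, map_add, hx, hy, TensorProduct.tmul_add]; abel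
        | tmul x y =>
          simp only [Algebra.TensorProduct.tmul_mul_tmul, one_mul, LinearMap.rTensor_tmul,
            deconc_ι_mul, TensorProduct.add_tmul, map_add, TensorProduct.assoc_tmul]
          congr 1
          induction deconc K V x with
          | zero => simp
          | add a b ha hb => simp only [mul_add, map_add, TensorProduct.add_tmul, ha, hb]
          | tmul a b => simp
      have h2 : ∀ t : TensorAlgebra K V ⊗[K] TensorAlgebra K V,
          (deconc K V).lTensor _ ((TensorAlgebra.ι K v ⊗ₜ 1) * t) =
            (TensorAlgebra.ι K v ⊗ₜ 1) * (deconc K V).lTensor _ t := by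
        intro t
        induction t with
        | zero => simp
        | add x y hx hy => simp only [mul_add, map_add, hx, hy]
        | tmul x y => simp
      rw [deconc_ι_mul, map_add, map_add, map_add, h1, h2, ih]
      simp [deconc_one, deconc_ι_mul, TensorProduct.tmul_add, add_assoc]
  rTensor_counit_comp_comul := by
    ext a
    simp only [LinearMap.comp_apply, TensorProduct.mk_apply]
    induction a using tensorAlgebra_left_induction with
    | one => simp [deconc_one]
    | add a b ha hb => simp only [map_add, ha, hb, TensorProduct.tmul_add]
    | smul r a ha => simp only [map_smul, ha, TensorProduct.tmul_smul]
    | cons v w ih =>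
      rw [deconc_ι_mul, map_add]
      have h : ∀ t : TensorAlgebra K V ⊗[K] TensorAlgebra K V,
          (TensorAlgebra.algebraMapInv.toLinearMap : TensorAlgebra K V →ₗ[K] K).rTensor _
            ((TensorAlgebra.ι K v ⊗ₜ 1) * t) = 0 := by
        intro t
        induction t with
        | zero => simp
        | add x y hx hy => simp only [mul_add, map_add, hx, hy, add_zero]
        | tmul x y => simp [TensorAlgebra.algebraMapInv]
      rw [h]
      simp
  lTensor_counit_comp_comul := by
    ext a
    simp only [LinearMap.comp_apply, LinearMap.flip_apply, TensorProduct.mk_apply]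
    induction a using tensorAlgebra_left_induction with
    | one => simp [deconc_one]
    | add a b ha hb => simp only [map_add, ha, hb, TensorProduct.add_tmul]
    | smul r a ha => simp only [map_smul, ha, TensorProduct.smul_tmul']
    | cons v w ih =>
      rw [deconc_ι_mul, map_add]
      have h : ∀ t : TensorAlgebra K V ⊗[K] TensorAlgebra K V,
          (TensorAlgebra.algebraMapInv.toLinearMap : TensorAlgebra K V →ₗ[K] K).lTensor _
            ((TensorAlgebra.ι K v ⊗ₜ 1) * t) =
          (TensorAlgebra.ι K v ⊗ₜ 1) * (TensorAlgebra.algebraMapInv.toLinearMap :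
            TensorAlgebra K V →ₗ[K] K).lTensor _ t := by
        intro t
        induction t with
        | zero => simp
        | add x y hx hy => simp only [mul_add, map_add, hx, hy]
        | tmul x y => simp
      rw [h, ih]
      simp [TensorAlgebra.algebraMapInv]

/-! ### `B_∞`-algebras -/

/-- A coalgebra morphism `⋆ : T(V) ⊗ T(V) → T(V)` makes the tensor coalgebra `T(V)` a Hopf algebra
with unit the empty word. -/
structure IsHopfProduct {K V : Type*} [Field K] [AddCommGroup V] [Module K V]
    (star : TensorAlgebra K V ⊗[K] TensorAlgebra K V →ₗc[K] TensorAlgebra K V) : Prop where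
  one_star : ∀ x, star (1 ⊗ₜ x) = x
  star_one : ∀ x, star (x ⊗ₜ 1) = x
  star_assoc : ∀ x y z, star (star (x ⊗ₜ y) ⊗ₜ z) = star (x ⊗ₜ star (y ⊗ₜ z))
  exists_antipode : ∃ S : TensorAlgebra K V →ₗ[K] TensorAlgebra K V, ∀ x,
    star (S.rTensor _ (Coalgebra.comul (R := K) x)) =
        algebraMap K _ (Coalgebra.counit (R := K) x) ∧
      star (S.lTensor _ (Coalgebra.comul (R := K) x)) =
        algebraMap K _ (Coalgebra.counit (R := K) x)

/-- Families of linear maps `V^{⊗ m} ⊗ V^{⊗ n} → V` for `m, n ≥ 1`. -/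
abbrev Brackets (K V : Type*) [Field K] [AddCommGroup V] [Module K V] :=
  ∀ m n : ℕ+, (⨂[K]^(m : ℕ) V) ⊗[K] (⨂[K]^(n : ℕ) V) →ₗ[K] V

/-- The family of brackets `br` is a `B_∞`-algebra structure on `V`: the coalgebra morphism
`⋆ : T(V) ⊗ T(V) → T(V)` with `π((x₁ ⋯ xₘ) ⋆ (y₁ ⋯ yₙ)) = br(x₁, …, xₘ; y₁, …, yₙ)` for
`m, n ≥ 1`, where `π` (`TensorAlgebra.ιInv`) is the projection on `V`, makes `T(V)` a Hopf
algebra. -/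
def IsBInfty {K V : Type*} [Field K] [AddCommGroup V] [Module K V] (br : Brackets K V) : Prop :=
  ∃ star : TensorAlgebra K V ⊗[K] TensorAlgebra K V →ₗc[K] TensorAlgebra K V,
    IsHopfProduct star ∧
    ∀ (m n : ℕ+) (x : Fin m → V) (y : Fin n → V),
      TensorAlgebra.ιInv (star (TensorAlgebra.tprod K V m x ⊗ₜ TensorAlgebra.tprod K V n y)) =
        br m n (PiTensorProduct.tprod K x ⊗ₜ PiTensorProduct.tprod K y)

/-- Morphisms of `B_∞`-algebras: linear maps that commute with all brackets. -/
def IsBInftyHom {K V W : Type*} [Field K] [AddCommGroup V] [Module K V] [AddCommGroup W]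
    [Module K W] (brV : Brackets K V) (brW : Brackets K W) (φ : V →ₗ[K] W) : Prop :=
  ∀ (m n : ℕ+) (x : Fin m → V) (y : Fin n → V),
    φ (brV m n (PiTensorProduct.tprod K x ⊗ₜ PiTensorProduct.tprod K y)) =
      brW m n (PiTensorProduct.tprod K (fun i => φ (x i)) ⊗ₜ
        PiTensorProduct.tprod K (fun j => φ (y j)))

/-! ### Double posets, plane posets, WN posets -/

/-- A double poset: a finite set with two partial orders `le₁` (written `≤_h` for plane posets)
and `le₂` (written `≤_r`). -/
structure DoublePoset : Type 1 where
  carrier : Type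
  finite : Finite carrier
  le₁ : carrier → carrier → Prop
  le₂ : carrier → carrier → Prop
  po₁ : IsPartialOrder carrier le₁
  po₂ : IsPartialOrder carrier le₂

namespace DoublePoset

/-- Two double posets are isomorphic. -/
def Iso (P Q : DoublePoset) : Prop :=
  ∃ e : P.carrier ≃ Q.carrier, ∀ x y,
    (P.le₁ x y ↔ Q.le₁ (e x) (e y)) ∧ (P.le₂ x y ↔ Q.le₂ (e x) (e y))

theorem Iso.refl (P : DoublePoset) : Iso P P := ⟨Equiv.refl _, fun _ _ => ⟨Iff.rfl, Iff.rfl⟩⟩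

theorem Iso.symm {P Q : DoublePoset} : Iso P Q → Iso Q P := fun ⟨e, he⟩ =>
  ⟨e.symm, fun x y => by
    have h := he (e.symm x) (e.symm y)
    simp only [Equiv.apply_symm_apply] at h
    exact ⟨h.1.symm, h.2.symm⟩⟩

theorem Iso.trans {P Q R : DoublePoset} : Iso P Q → Iso Q R → Iso P R := fun ⟨e, he⟩ ⟨f, hf⟩ =>
  ⟨e.trans f, fun x y => ⟨(he x y).1.trans (hf _ _).1, (he x y).2.trans (hf _ _).2⟩⟩

/-- The double subposet of `P` on the subset `I`. -/
def restrict (P : DoublePoset) (I : Set P.carrier) : DoublePoset where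
  carrier := I
  finite := haveI := P.finite; inferInstance
  le₁ x y := P.le₁ x y
  le₂ x y := P.le₂ x y
  po₁ := haveI := P.po₁
    { refl := fun x => refl_of P.le₁ (x : P.carrier)
      trans := fun _ _ _ h h' => trans_of P.le₁ h h'
      antisymm := fun _ _ h h' => Subtype.ext (antisymm_of P.le₁ h h') }
  po₂ := haveI := P.po₂
    { refl := fun x => refl_of P.le₂ (x : P.carrier)
      trans := fun _ _ _ h h' => trans_of P.le₂ h h'
      antisymm := fun _ _ h h' => Subtype.ext (antisymm_of P.le₂ h h') }

/-- The product `P · Q`: the disjoint union of `P` and `Q`, where `x ≤₂ y` and `x, y` are not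
comparable for `≤₁` whenever `x ∈ P` and `y ∈ Q`. -/
def prod (P Q : DoublePoset) : DoublePoset where
  carrier := P.carrier ⊕ Q.carrier
  finite := haveI := P.finite; haveI := Q.finite; inferInstance
  le₁ := Sum.LiftRel P.le₁ Q.le₁
  le₂ := Sum.Lex P.le₂ Q.le₂
  po₁ := haveI := P.po₁; haveI := Q.po₁; { }
  po₂ := haveI := P.po₂; haveI := Q.po₂; { }

/-- The empty double poset. -/
def empty : DoublePoset where
  carrier := Empty
  finite := inferInstance
  le₁ _ _ := True
  le₂ _ _ := True
  po₁ := { refl := fun x => x.elim, trans := fun x => x.elim, antisymm := fun x => x.elim }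
  po₂ := { refl := fun x => x.elim, trans := fun x => x.elim, antisymm := fun x => x.elim }

/-- The double poset with one element. -/
def point : DoublePoset where
  carrier := Unit
  finite := inferInstance
  le₁ _ _ := True
  le₂ _ _ := True
  po₁ := { refl := fun _ => trivial, trans := fun _ _ _ _ _ => trivial,
           antisymm := fun _ _ _ _ => rfl }
  po₂ := { refl := fun _ => trivial, trans := fun _ _ _ _ _ => trivial,
           antisymm := fun _ _ _ _ => rfl }

/-- A double poset is plane if any two distinct elements are comparable for exactly one of the
two orders. -/
def IsPlane (P : DoublePoset) : Prop :=
  ∀ x y, x ≠ y → ((P.le₁ x y ∨ P.le₁ y x) ↔ ¬ (P.le₂ x y ∨ P.le₂ y x))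

/-- `P` has a double subposet isomorphic to `Q`. -/
def Contains (P Q : DoublePoset) : Prop := ∃ I : Set P.carrier, Iso Q (P.restrict I)

/-- The reflexive relation on `Fin 4` given by a list of pairs. -/
def listRel (l : List (Fin 4 × Fin 4)) (x y : Fin 4) : Prop := x = y ∨ (x, y) ∈ l

instance (l : List (Fin 4 × Fin 4)) : DecidableRel (listRel l) := fun _ _ => instDecidableOr

/-- The first plane poset of shape N, on the vertices `0, 1, 2, 3`: `0 <_h 2`, `0 <_h 3`,
`1 <_h 3` and `0 <_r 1`, `2 <_r 1`, `2 <_r 3`. -/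
def posetN : DoublePoset where
  carrier := Fin 4
  finite := inferInstance
  le₁ := listRel [(0, 2), (0, 3), (1, 3)]
  le₂ := listRel [(0, 1), (2, 1), (2, 3)]
  po₁ := { refl := by decide, trans := by decide, antisymm := by decide }
  po₂ := { refl := by decide, trans := by decide, antisymm := by decide }

/-- The second plane poset of shape N, on the vertices `0, 1, 2, 3`: `0 <_h 2`, `1 <_h 2`,
`1 <_h 3` and `0 <_r 1`, `0 <_r 3`, `2 <_r 3`. -/
def posetN' : DoublePoset where
  carrier := Fin 4
  finite := inferInstance
  le₁ := listRel [(0, 2), (1, 2), (1, 3)]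
  le₂ := listRel [(0, 1), (0, 3), (2, 3)]
  po₁ := { refl := by decide, trans := by decide, antisymm := by decide }
  po₂ := { refl := by decide, trans := by decide, antisymm := by decide }

/-- WN ("without N") posets. -/
def IsWN (P : DoublePoset) : Prop :=
  P.IsPlane ∧ ¬ P.Contains posetN ∧ ¬ P.Contains posetN'

/-- `P` is `h`-connected: it is nonempty and any two elements are joined by a path of
`≤₁`-comparable elements. -/
def HConnected (P : DoublePoset) : Prop :=
  Nonempty P.carrier ∧ ∀ x y, Relation.ReflTransGen (fun a b => P.le₁ a b ∨ P.le₁ b a) x y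

/-- Ideals are the subsets that are closed upwards for `≤₁`. -/
def IsIdeal (P : DoublePoset) (I : Set P.carrier) : Prop :=
  ∀ x ∈ I, ∀ y, P.le₁ x y → y ∈ I

theorem prod_congr {P P' Q Q' : DoublePoset} : Iso P P' → Iso Q Q' →
    Iso (P.prod Q) (P'.prod Q') := fun ⟨e, he⟩ ⟨f, hf⟩ => by
  have key : ∀ x y : P.carrier ⊕ Q.carrier,
      (Sum.LiftRel P.le₁ Q.le₁ x y ↔ Sum.LiftRel P'.le₁ Q'.le₁ (Sum.map e f x) (Sum.map e f y)) ∧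
      (Sum.Lex P.le₂ Q.le₂ x y ↔ Sum.Lex P'.le₂ Q'.le₂ (Sum.map e f x) (Sum.map e f y)) := by
    rintro (x | x) (y | y)
    · simpa using he x y
    · simp
    · simp
    · simpa using hf x y
  exact ⟨Equiv.sumCongr e f, key⟩

theorem prod_assoc (P Q R : DoublePoset) : Iso ((P.prod Q).prod R) (P.prod (Q.prod R)) := by
  let e := Equiv.sumAssoc P.carrier Q.carrier R.carrier
  have key : ∀ x y : (P.carrier ⊕ Q.carrier) ⊕ R.carrier,
      (Sum.LiftRel (Sum.LiftRel P.le₁ Q.le₁) R.le₁ x y ↔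
        Sum.LiftRel P.le₁ (Sum.LiftRel Q.le₁ R.le₁) (e x) (e y)) ∧
      (Sum.Lex (Sum.Lex P.le₂ Q.le₂) R.le₂ x y ↔
        Sum.Lex P.le₂ (Sum.Lex Q.le₂ R.le₂) (e x) (e y)) := by
    rintro ((x | x) | x) ((y | y) | y) <;> simp [e]
  exact ⟨e, key⟩

theorem empty_prod (P : DoublePoset) : Iso (empty.prod P) P := by
  let e := Equiv.emptySum Empty P.carrier
  have key : ∀ x y : Empty ⊕ P.carrier,
      (Sum.LiftRel (fun _ _ => True) P.le₁ x y ↔ P.le₁ (e x) (e y)) ∧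
      (Sum.Lex (fun _ _ => True) P.le₂ x y ↔ P.le₂ (e x) (e y)) := by
    rintro (x | x) (y | y)
    · exact x.elim
    · exact x.elim
    · exact y.elim
    · simp [e]
  exact ⟨e, key⟩

theorem prod_empty (P : DoublePoset) : Iso (P.prod empty) P := by
  let e := Equiv.sumEmpty P.carrier Empty
  have key : ∀ x y : P.carrier ⊕ Empty,
      (Sum.LiftRel P.le₁ (fun _ _ => True) x y ↔ P.le₁ (e x) (e y)) ∧
      (Sum.Lex P.le₂ (fun _ _ => True) x y ↔ P.le₂ (e x) (e y)) := by
    rintro (x | x) (y | y)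
    · simp [e]
    · exact y.elim
    · exact x.elim
    · exact x.elim
  exact ⟨e, key⟩

theorem iso_empty (P : DoublePoset) (h : IsEmpty P.carrier) : Iso P empty :=
  ⟨Equiv.equivOfIsEmpty P.carrier Empty, fun x => h.elim x⟩

theorem Iso.hConnected {P Q : DoublePoset} : Iso P Q → P.HConnected → Q.HConnected := by
  rintro ⟨e, he⟩ ⟨⟨x₀⟩, h⟩
  refine ⟨⟨e x₀⟩, fun x y => ?_⟩
  have key : ∀ a b, Relation.ReflTransGen (fun a b => P.le₁ a b ∨ P.le₁ b a) a b →
      Relation.ReflTransGen (fun a b => Q.le₁ a b ∨ Q.le₁ b a) (e a) (e b) := by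
    intro a b hab
    induction hab with
    | refl => exact .refl
    | tail _ h ih =>
      rw [(he _ _).1, (he _ _).1] at h
      exact ih.tail h
  simpa using key _ _ (h (e.symm x) (e.symm y))

/-- A product of two nonempty double posets is not `h`-connected. -/
theorem not_hConnected_prod {P Q : DoublePoset} (x : P.carrier) (y : Q.carrier) :
    ¬ (P.prod Q).HConnected := by
  rintro ⟨-, h⟩
  have key : ∀ z : (P.prod Q).carrier, Relation.ReflTransGen
      (fun a b => (P.prod Q).le₁ a b ∨ (P.prod Q).le₁ b a) (Sum.inl x) z →
        ∃ p : P.carrier, z = Sum.inl p := by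
    intro z hz
    induction hz with
    | refl => exact ⟨x, rfl⟩
    | @tail b c _ hbc ih =>
      obtain ⟨p, rfl⟩ := ih
      rcases c with c | c
      · exact ⟨c, rfl⟩
      · simp [prod] at hbc
  obtain ⟨p, hp⟩ := key _ (h (Sum.inl x) (Sum.inr y))
  cases hp

theorem contains_iff {P Q : DoublePoset} : P.Contains Q ↔
    ∃ f : Q.carrier → P.carrier, Function.Injective f ∧ ∀ x y,
      (Q.le₁ x y ↔ P.le₁ (f x) (f y)) ∧ (Q.le₂ x y ↔ P.le₂ (f x) (f y)) := by
  constructor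
  · rintro ⟨I, e, he⟩
    exact ⟨fun x => (e x : I).1, fun x y h => e.injective (Subtype.ext h), he⟩
  · rintro ⟨f, hf, h⟩
    exact ⟨Set.range f, Equiv.ofInjective f hf, h⟩

theorem Iso.contains {P P' Q : DoublePoset} : Iso P P' → P.Contains Q → P'.Contains Q := by
  rintro ⟨e, he⟩ h
  obtain ⟨f, hf, h⟩ := contains_iff.1 h
  exact contains_iff.2 ⟨e ∘ f, e.injective.comp hf, fun x y =>
    ⟨(h x y).1.trans (he _ _).1, (h x y).2.trans (he _ _).2⟩⟩

/-- An `h`-connected double poset contained in a product is contained in one of the factors. -/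
theorem contains_of_prod {P P' Q : DoublePoset} (hQ : Q.HConnected)
    (h : (P.prod P').Contains Q) : P.Contains Q ∨ P'.Contains Q := by
  obtain ⟨f, hf, h⟩ := contains_iff.1 h
  obtain ⟨⟨x₀⟩, hc⟩ := hQ
  rcases hx : f x₀ with p | p
  · left
    have key : ∀ z, ∃ p : P.carrier, f z = Sum.inl p := by
      intro z
      induction hc x₀ z with
      | refl => exact ⟨p, hx⟩
      | @tail b c _ hbc ih =>
        obtain ⟨q, hq⟩ := ih
        rw [(h _ _).1, (h _ _).1, hq] at hbc
        rcases hc' : f c with r | r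
        · exact ⟨r, rfl⟩
        · rw [hc'] at hbc; simp [prod] at hbc
    choose g hg using key
    refine contains_iff.2 ⟨g, fun x y hxy => hf (by rw [hg, hg, hxy]), fun x y => ?_⟩
    rw [(h x y).1, (h x y).2, hg, hg]
    simp [prod]
  · right
    have key : ∀ z, ∃ p : P'.carrier, f z = Sum.inr p := by
      intro z
      induction hc x₀ z with
      | refl => exact ⟨p, hx⟩
      | @tail b c _ hbc ih =>
        obtain ⟨q, hq⟩ := ih
        rw [(h _ _).1, (h _ _).1, hq] at hbc
        rcases hc' : f c with r | r
        · rw [hc'] at hbc; simp [prod] at hbc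
        · exact ⟨r, rfl⟩
    choose g hg using key
    refine contains_iff.2 ⟨g, fun x y hxy => hf (by rw [hg, hg, hxy]), fun x y => ?_⟩
    rw [(h x y).1, (h x y).2, hg, hg]
    simp [prod]

theorem hConnected_posetN : posetN.HConnected := by
  have h : ∀ x y : Fin 4, ∃ a b : Fin 4,
      (listRel [(0, 2), (0, 3), (1, 3)] x a ∨ listRel [(0, 2), (0, 3), (1, 3)] a x) ∧
      (listRel [(0, 2), (0, 3), (1, 3)] a b ∨ listRel [(0, 2), (0, 3), (1, 3)] b a) ∧
      (listRel [(0, 2), (0, 3), (1, 3)] b y ∨ listRel [(0, 2), (0, 3), (1, 3)] y b) := by decide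
  refine ⟨⟨(0 : Fin 4)⟩, fun x y => ?_⟩
  obtain ⟨a, b, h1, h2, h3⟩ := h x y
  have h1' : posetN.le₁ x a ∨ posetN.le₁ a x := h1
  have h2' : posetN.le₁ a b ∨ posetN.le₁ b a := h2
  have h3' : posetN.le₁ b y ∨ posetN.le₁ y b := h3
  exact .head h1' (.head h2' (.single h3'))

theorem hConnected_posetN' : posetN'.HConnected := by
  have h : ∀ x y : Fin 4, ∃ a b : Fin 4,
      (listRel [(0, 2), (1, 2), (1, 3)] x a ∨ listRel [(0, 2), (1, 2), (1, 3)] a x) ∧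
      (listRel [(0, 2), (1, 2), (1, 3)] a b ∨ listRel [(0, 2), (1, 2), (1, 3)] b a) ∧
      (listRel [(0, 2), (1, 2), (1, 3)] b y ∨ listRel [(0, 2), (1, 2), (1, 3)] y b) := by decide
  refine ⟨⟨(0 : Fin 4)⟩, fun x y => ?_⟩
  obtain ⟨a, b, h1, h2, h3⟩ := h x y
  have h1' : posetN'.le₁ x a ∨ posetN'.le₁ a x := h1
  have h2' : posetN'.le₁ a b ∨ posetN'.le₁ b a := h2
  have h3' : posetN'.le₁ b y ∨ posetN'.le₁ y b := h3
  exact .head h1' (.head h2' (.single h3'))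

theorem IsWN.prod {P Q : DoublePoset} (hP : P.IsWN) (hQ : Q.IsWN) : (P.prod Q).IsWN := by
  refine ⟨?_, fun h => ?_, fun h => ?_⟩
  · rintro (x | x) (y | y) hxy
    · simpa [DoublePoset.prod] using hP.1 x y (fun h => hxy (congrArg _ h))
    · simp [DoublePoset.prod]
    · simp [DoublePoset.prod]
    · simpa [DoublePoset.prod] using hQ.1 x y (fun h => hxy (congrArg _ h))
  · exact (contains_of_prod hConnected_posetN h).elim hP.2.1 hQ.2.1
  · exact (contains_of_prod hConnected_posetN' h).elim hP.2.2 hQ.2.2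

theorem isWN_of_subsingleton {P : DoublePoset} (h : Subsingleton P.carrier) : P.IsWN := by
  refine ⟨fun x y hxy => (hxy (Subsingleton.elim x y)).elim, fun hc => ?_, fun hc => ?_⟩
  · obtain ⟨f, hf, -⟩ := contains_iff.1 hc
    exact absurd (hf (Subsingleton.elim (f (0 : Fin 4)) (f (1 : Fin 4))))
      (by decide : ¬ (0 : Fin 4) = 1)
  · obtain ⟨f, hf, -⟩ := contains_iff.1 hc
    exact absurd (hf (Subsingleton.elim (f (0 : Fin 4)) (f (1 : Fin 4))))
      (by decide : ¬ (0 : Fin 4) = 1)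

end DoublePoset

/-- Isomorphism of WN posets. -/
instance wnSetoid : Setoid {P : DoublePoset // P.IsWN} where
  r P Q := DoublePoset.Iso P.1 Q.1
  iseqv := ⟨fun P => .refl P.1, fun h => h.symm, fun h h' => h.trans h'⟩

/-- Isoclasses of WN posets. -/
def WNP : Type 1 := Quotient wnSetoid

namespace WNP

/-- The isoclass of a WN poset. -/
def mk (P : DoublePoset) (hP : P.IsWN) : WNP := Quotient.mk wnSetoid ⟨P, hP⟩

/-- A WN poset in a given isoclass. -/
noncomputable def rep (P : WNP) : DoublePoset := (Quotient.out P).1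

theorem rep_isWN (P : WNP) : P.rep.IsWN := (Quotient.out P).2

theorem mk_eq_mk {P Q : DoublePoset} {hP : P.IsWN} {hQ : Q.IsWN} :
    mk P hP = mk Q hQ ↔ DoublePoset.Iso P Q :=
  Quotient.eq (r := wnSetoid)

theorem mk_rep (P : WNP) : mk P.rep P.rep_isWN = P := Quotient.out_eq P

theorem rep_mk (P : DoublePoset) (hP : P.IsWN) : DoublePoset.Iso (mk P hP).rep P :=
  mk_eq_mk.1 (mk_rep (mk P hP))

theorem eq_of_iso {P Q : WNP} (h : DoublePoset.Iso P.rep Q.rep) : P = Q := by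
  rw [← mk_rep P, ← mk_rep Q]; exact mk_eq_mk.2 h

/-- Isoclasses of WN posets form a monoid for the product `P · Q`, with unit the empty poset. -/
noncomputable instance : Monoid WNP where
  mul := Quotient.map₂ (fun P Q => ⟨P.1.prod Q.1, P.2.prod Q.2⟩)
    (fun _ _ h _ _ h' => DoublePoset.prod_congr h h')
  one := mk DoublePoset.empty (DoublePoset.isWN_of_subsingleton ⟨fun x => x.elim⟩)
  mul_assoc P Q R := by
    induction P, Q using Quotient.inductionOn₂ with | _ P Q
    induction R using Quotient.inductionOn with | _ R
    exact Quotient.sound (DoublePoset.prod_assoc P.1 Q.1 R.1)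
  one_mul P := by
    induction P using Quotient.inductionOn with | _ P
    exact Quotient.sound (DoublePoset.empty_prod P.1)
  mul_one P := by
    induction P using Quotient.inductionOn with | _ P
    exact Quotient.sound (DoublePoset.prod_empty P.1)

theorem mk_mul_mk {P Q : DoublePoset} (hP : P.IsWN) (hQ : Q.IsWN) :
    mk P hP * mk Q hQ = mk (P.prod Q) (hP.prod hQ) := rfl

theorem mul_rep (P Q : WNP) : DoublePoset.Iso (P * Q).rep (P.rep.prod Q.rep) := by
  conv_lhs => rw [← mk_rep P, ← mk_rep Q, mk_mul_mk]
  exact rep_mk _ _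

theorem eq_one_of_isEmpty {P : WNP} (h : IsEmpty P.rep.carrier) : P = 1 := by
  rw [← mk_rep P]; exact mk_eq_mk.2 (DoublePoset.iso_empty _ h)

/-- The number of elements. -/
noncomputable def card (P : WNP) : ℕ := Nat.card P.rep.carrier

theorem card_mul (P Q : WNP) : (P * Q).card = P.card + Q.card := by
  obtain ⟨e, -⟩ := mul_rep P Q
  have := P.rep.finite
  have := Q.rep.finite
  exact (Nat.card_congr e).trans Nat.card_sum

theorem finite_card_eq (n : ℕ) : {P : WNP | P.card = n}.Finite := by
  have he : ∀ P : {P : WNP // P.card = n}, Nonempty (Fin n ≃ P.1.rep.carrier) := fun P =>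
    have := P.1.rep.finite
    ⟨(Finite.equivFinOfCardEq P.2).symm⟩
  let e := fun P => (he P).some
  let f : {P : WNP // P.card = n} → (Fin n → Fin n → Prop) × (Fin n → Fin n → Prop) := fun P =>
    (fun i j => P.1.rep.le₁ (e P i) (e P j), fun i j => P.1.rep.le₂ (e P i) (e P j))
  have hf : Function.Injective f := by
    intro P Q h
    refine Subtype.ext (eq_of_iso ⟨(e P).symm.trans (e Q), fun x y => ?_⟩)
    have h1 := congrFun (congrFun (congrArg Prod.fst h) ((e P).symm x)) ((e P).symm y)
    have h2 := congrFun (congrFun (congrArg Prod.snd h) ((e P).symm x)) ((e P).symm y)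
    simp only [f, Equiv.apply_symm_apply] at h1 h2
    exact ⟨Iff.of_eq h1, Iff.of_eq h2⟩
  exact Set.finite_coe_iff.1 (Finite.of_injective f hf)

/-- `h`-connected WN posets. -/
def HConnected (P : WNP) : Prop := P.rep.HConnected

/-- The one-point poset. -/
def point : WNP := mk DoublePoset.point (DoublePoset.isWN_of_subsingleton ⟨fun _ _ => rfl⟩)

theorem point_hConnected : point.HConnected :=
  (rep_mk _ _).symm.hConnected ⟨⟨()⟩, fun _ _ => Relation.ReflTransGen.single (Or.inl trivial)⟩

/-- The number `n(P, Q; R)` of ideals `I` of `R` such that `R ∖ I` is isomorphic to `P` and `I` is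
isomorphic to `Q`. -/
noncomputable def numIdeals (P Q R : WNP) : ℕ :=
  {I : Set R.rep.carrier | R.rep.IsIdeal I ∧ DoublePoset.Iso (R.rep.restrict Iᶜ) P.rep ∧
    DoublePoset.Iso (R.rep.restrict I) Q.rep}.ncard

theorem card_of_numIdeals_ne_zero {P Q R : WNP} (h : numIdeals P Q R ≠ 0) :
    R.card = P.card + Q.card := by
  obtain ⟨I, -, ⟨e, -⟩, ⟨f, -⟩⟩ := Set.nonempty_of_ncard_ne_zero h
  have := R.rep.finite
  have h1 := Nat.card_congr e
  have h2 := Nat.card_congr f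
  have h3 := Set.ncard_add_ncard_compl I
  rw [card, card, card, ← h1, ← h2, ← h3, add_comm]
  rfl

theorem finite_numIdeals (P Q : WNP) : {R : WNP | numIdeals P Q R ≠ 0}.Finite :=
  (finite_card_eq (P.card + Q.card)).subset fun _ h => card_of_numIdeals_ne_zero h

theorem finite_factorizations (P : WNP) : {p : WNP × WNP | p.1 * p.2 = P}.Finite := by
  have h : (⋃ n ∈ Finset.range (P.card + 1), {Q : WNP | Q.card = n}).Finite :=
    Set.Finite.biUnion (Finset.finite_toSet _) fun n _ => finite_card_eq n
  refine (h.prod h).subset ?_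
  rintro ⟨Q, R⟩ rfl
  have := card_mul Q R
  simp only [Set.mem_prod, Set.mem_iUnion, Set.mem_ofPred_eq, Finset.mem_range, exists_prop,
    exists_eq_right']
  omega

/-- An `h`-connected poset only has the two trivial factorizations. -/
theorem mul_eq_iff_of_hConnected {P Q R : WNP} (hP : P.HConnected) :
    Q * R = P ↔ (Q = P ∧ R = 1) ∨ (Q = 1 ∧ R = P) := by
  constructor
  · rintro rfl
    rcases isEmpty_or_nonempty Q.rep.carrier with h | ⟨⟨x⟩⟩
    · right; simp [eq_one_of_isEmpty h]
    rcases isEmpty_or_nonempty R.rep.carrier with h | ⟨⟨y⟩⟩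
    · left; simp [eq_one_of_isEmpty h]
    exact (DoublePoset.not_hConnected_prod x y ((mul_rep Q R).hConnected hP)).elim
  · rintro (⟨rfl, rfl⟩ | ⟨rfl, rfl⟩) <;> simp

theorem ne_one_of_hConnected {P : WNP} (hP : P.HConnected) : P ≠ 1 := by
  rintro rfl
  obtain ⟨⟨x⟩, -⟩ := (rep_mk _ _).hConnected hP
  exact x.elim

end WNP

/-! ### The algebra of WN posets -/

/-- The vector space `H_WNP` with basis the isoclasses of WN posets. Its multiplication is the
linear extension of the product `P · Q`. -/
abbrev HWNP (K : Type*) [Field K] := MonoidAlgebra K WNP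

/-- The product `⋆` of `H_WNP`, given by `P ⋆ Q = ∑_R n(P, Q; R) R`. -/
noncomputable def starProd (K : Type*) [Field K] : HWNP K →ₗ[K] HWNP K →ₗ[K] HWNP K :=
  (MonoidAlgebra.basis WNP K).constr K fun P =>
    (MonoidAlgebra.basis WNP K).constr K fun Q =>
      ∑ R ∈ (WNP.finite_numIdeals P Q).toFinset,
        (WNP.numIdeals P Q R : K) • MonoidAlgebra.single R 1

/-- The coproduct of `H_WNP` dual to `·`, given by `P ↦ ∑_{Q · R = P} Q ⊗ R`. -/
noncomputable def comulWNP (K : Type*) [Field K] : HWNP K →ₗ[K] HWNP K ⊗[K] HWNP K :=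
  (MonoidAlgebra.basis WNP K).constr K fun P =>
    ∑ p ∈ (WNP.finite_factorizations P).toFinset,
      MonoidAlgebra.single p.1 1 ⊗ₜ[K] MonoidAlgebra.single p.2 1

/-- The space `Prim(H_WNP)` of the elements `x` with `Δ(x) = x ⊗ 1 + 1 ⊗ x`, where `Δ` is
`comulWNP`. -/
noncomputable def Prim (K : Type*) [Field K] : Submodule K (HWNP K) :=
  LinearMap.eqLocus (comulWNP K)
    ((TensorProduct.mk K (HWNP K) (HWNP K)).flip 1 + TensorProduct.mk K (HWNP K) (HWNP K) 1)

theorem mem_prim {K : Type*} [Field K] {x : HWNP K} :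
    x ∈ Prim K ↔ comulWNP K x = x ⊗ₜ 1 + 1 ⊗ₜ x := Iff.rfl

theorem single_mem_prim (K : Type*) [Field K] {P : WNP} (hP : P.HConnected) :
    (MonoidAlgebra.single P 1 : HWNP K) ∈ Prim K := by
  classical
  have h : (WNP.finite_factorizations P).toFinset = {(P, 1), (1, P)} := by
    ext ⟨Q, R⟩
    simp [WNP.mul_eq_iff_of_hConnected hP]
  have hne : (P, (1 : WNP)) ≠ (1, P) := fun h =>
    WNP.ne_one_of_hConnected hP (congrArg Prod.fst h)
  rw [mem_prim, comulWNP, ← MonoidAlgebra.basis_apply, Module.Basis.constr_basis, h,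
    Finset.sum_pair hne]
  rfl

open Classical in
/-- The canonical projection `π : H_WNP → Prim(H_WNP)`: it fixes the `h`-connected posets and
sends the other ones (the empty poset included) to `0`. -/
noncomputable def primProj (K : Type*) [Field K] : HWNP K →ₗ[K] Prim K :=
  (MonoidAlgebra.basis WNP K).constr K fun P =>
    if hP : P.HConnected then ⟨MonoidAlgebra.single P 1, single_mem_prim K hP⟩ else 0

/-- The linear map `Prim(H_WNP)^{⊗ n} → H_WNP`, `P₁ ⊗ ⋯ ⊗ Pₙ ↦ P₁ · ⋯ · Pₙ`. -/
noncomputable def primMul (K : Type*) [Field K] (n : ℕ) : (⨂[K]^n (Prim K)) →ₗ[K] HWNP K :=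
  PiTensorProduct.lift
    ((MultilinearMap.mkPiAlgebraFin K n (HWNP K)).compLinearMap fun _ => (Prim K).subtype)

/-- The brackets of `Prim(H_WNP)`:
`[P₁, …, Pₘ; Q₁, …, Qₙ] = π ((P₁ · ⋯ · Pₘ) ⋆ (Q₁ · ⋯ · Qₙ))`. -/
noncomputable def primBrackets (K : Type*) [Field K] : Brackets K (Prim K) := fun m n =>
  primProj K ∘ₗ TensorProduct.lift (starProd K) ∘ₗ TensorProduct.map (primMul K m) (primMul K n)

/-- The one-point poset, as an element of `Prim(H_WNP)`. -/
noncomputable def primPoint (K : Type*) [Field K] : Prim K :=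
  ⟨MonoidAlgebra.single WNP.point 1, single_mem_prim K WNP.point_hConnected⟩

end BInf

/-!
By Levi's lemma for the product and Seinsche's theorem on graphs without induced paths on four
vertices, the WN posets form a free monoid on the `h`-connected ones, and exchanging the two orders
turns this into a unique decomposition of every WN poset for `stack`, the disjoint union that puts
its second factor above the first one for `≤₁`. Hence `H_WNP` is `T(Prim(H_WNP))`, both as an
algebra and as a coalgebra, and the brackets are the projections on `Prim(H_WNP)` of the product
`⋆` transported to `T(Prim(H_WNP))`; the antipode is a geometric series, since the coproduct is
conilpotent.

The product `⋆` is triangular: `Q ⋆ R` is `stack Q R` plus posets with fewer `≤₁`-related pairs.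
A WN poset with at least two points is a nontrivial product or a nontrivial stack, so the one-point
poset generates `H_WNP` under both products, and a recursion on the number of `≤₁`-related pairs
defines the morphism to `T(B)` that sends this poset to the letter `x`.
-/

namespace BInf

/-! ### Graphs without induced paths on four vertices -/

section Seinsche

open SimpleGraph

variable {V : Type*} {G : SimpleGraph V}

theorem pathGraph_four_isIndContained {a b c d : V} (hab : G.Adj a b) (hbc : G.Adj b c)
    (hcd : G.Adj c d) (hac : ¬ G.Adj a c) (hbd : ¬ G.Adj b d) (had : ¬ G.Adj a d) :
    pathGraph 4 ⊴ G := by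
  have hac_ne : a ≠ c := fun h => had (h ▸ hcd)
  have hbd_ne : b ≠ d := fun h => had (h ▸ hab)
  have had_ne : a ≠ d := fun h => hac (h ▸ hcd.symm)
  refine ⟨⟨⟨![a, b, c, d], fun i j h => ?_⟩, fun {i j} => ?_⟩⟩
  · fin_cases i <;> fin_cases j <;>
      simp_all [hab.ne, hbc.ne, hcd.ne, hab.ne', hbc.ne', hcd.ne', hac_ne.symm, hbd_ne.symm,
        had_ne.symm]
  · change G.Adj (![a, b, c, d] i) (![a, b, c, d] j) ↔ _
    fin_cases i <;> fin_cases j <;>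
      simp [pathGraph_adj, hab, hbc, hcd, hac, hbd, had, hab.symm, hbc.symm, hcd.symm,
        mt Adj.symm hac, mt Adj.symm hbd, mt Adj.symm had]

theorem pathGraph_four_isIndContained_compl : pathGraph 4 ⊴ (pathGraph 4)ᶜ :=
  pathGraph_four_isIndContained (a := 1) (b := 3) (c := 0) (d := 2)
    (by simp [pathGraph_adj]) (by simp [pathGraph_adj]) (by simp [pathGraph_adj])
    (by simp [pathGraph_adj]) (by simp [pathGraph_adj]) (by simp [pathGraph_adj])

theorem exists_adj_boundary (hG : G.Preconnected) {S : Set V} {a b : V} (ha : a ∈ S)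
    (hb : b ∉ S) : ∃ x ∈ S, ∃ y ∉ S, G.Adj x y := by
  obtain ⟨p⟩ := hG a b
  obtain ⟨d, -, hx, hy⟩ := p.exists_boundary_dart S ha hb
  exact ⟨d.fst, hx, d.snd, hy, d.adj⟩

theorem exists_reachable_induce_compl_singleton_adj (hG : G.Preconnected) {v : V}
    (w : ({v}ᶜ : Set V)) :
    ∃ x : ({v}ᶜ : Set V), (G.induce {v}ᶜ).Reachable w x ∧ G.Adj x v := by
  obtain ⟨_, ⟨x, hwx, rfl⟩, y, hy, hxy⟩ := exists_adj_boundary hG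
    (S := Subtype.val '' {x | (G.induce {v}ᶜ).Reachable w x}) ⟨w, .refl w, rfl⟩
    (show v ∉ _ from fun ⟨x, _, hx⟩ => x.2 hx)
  obtain rfl : y = v := by
    by_contra hyv
    exact hy ⟨⟨y, hyv⟩, hwx.trans (Adj.reachable (G := G.induce {v}ᶜ) hxy), rfl⟩
  exact ⟨x, hwx, hxy⟩

theorem pathGraph_four_isIndContained_of_not_preconnected_induce (hG : G.Preconnected)
    (hGc : Gᶜ.Preconnected) {v : V} (h : ¬ (G.induce {v}ᶜ).Preconnected) :
    pathGraph 4 ⊴ G := by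
  have exists_not_reachable : ∀ y, ∃ w, ¬ (G.induce {v}ᶜ).Reachable y w := by
    by_contra! hy
    obtain ⟨y, hy⟩ := hy
    exact h fun a b => (hy a).symm.trans (hy b)
  obtain ⟨y, hyv⟩ : ∃ y : ({v}ᶜ : Set V), ¬ G.Adj y v := by
    simp only [Preconnected, not_forall] at h
    obtain ⟨w, -⟩ := h
    obtain ⟨x, hxv : x = v, y, hy, hxy⟩ := exists_adj_boundary hGc (Set.mem_singleton v) w.2
    exact ⟨⟨y, hy⟩, mt Adj.symm ((G.compl_adj v y).1 (hxv ▸ hxy)).2⟩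
  obtain ⟨x, ⟨p⟩, hxv⟩ := exists_reachable_induce_compl_singleton_adj hG y
  obtain ⟨⟨⟨y', x'⟩, hyx'⟩, -, hyv', hxv'⟩ :=
    p.exists_boundary_dart {z | ¬ G.Adj z v} hyv (not_not.2 hxv)
  obtain ⟨w, hw⟩ := exists_not_reachable y'
  obtain ⟨z, hwz, hzv⟩ := exists_reachable_induce_compl_singleton_adj hG w
  have hyz : ¬ (G.induce {v}ᶜ).Reachable y' z := fun hyz => hw (hyz.trans hwz.symm)
  exact pathGraph_four_isIndContained (d := (z : V)) hyx' (not_not.1 hxv') hzv.symm hyv'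
    (fun hxz => hyz (hyx'.reachable.trans (Adj.reachable (G := G.induce {v}ᶜ) hxz)))
    (fun hyz' => hyz (Adj.reachable (G := G.induce {v}ᶜ) hyz'))

/-- Seinsche's theorem, by deleting a vertex `v`. If this disconnects `G`, the path consists of an
edge from a non-neighbour to a neighbour of `v` in one component, then `v`, then a neighbour of `v`
in another component. -/
theorem pathGraph_four_isIndContained_of_preconnected [Finite V] [Nontrivial V]
    (hG : G.Preconnected) (hGc : Gᶜ.Preconnected) : pathGraph 4 ⊴ G := by
  induction hn : Nat.card V using Nat.strong_induction_on generalizing V with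
  | _ n ih =>
    obtain ⟨v, w, hvw⟩ := exists_pair_ne V
    have hcompl : (G.induce {v}ᶜ)ᶜ = Gᶜ.induce {v}ᶜ := by
      ext a b
      simp [Subtype.ext_iff]
    by_cases hW : (G.induce {v}ᶜ).Preconnected
    · by_cases hWc : (Gᶜ.induce {v}ᶜ).Preconnected
      · rcases subsingleton_or_nontrivial ({v}ᶜ : Set V) with _ | _
        · obtain ⟨x, -, hxv⟩ := exists_reachable_induce_compl_singleton_adj hG ⟨w, hvw.symm⟩
          obtain ⟨y, -, hyv⟩ := exists_reachable_induce_compl_singleton_adj hGc ⟨w, hvw.symm⟩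
          exact absurd (Subsingleton.elim x y ▸ hxv) ((G.compl_adj y v).1 hyv).2
        · have hcard : Nat.card ({v}ᶜ : Set V) < n := by
            rw [← hn]
            exact Set.ncard_lt_card (fun h => (h ▸ Set.mem_univ v : v ∈ ({v}ᶜ : Set V)) rfl)
          exact (ih _ hcard hW (hcompl ▸ hWc) rfl).trans ⟨Embedding.induce _⟩
      · have hN : pathGraph 4 ⊴ Gᶜ :=
          pathGraph_four_isIndContained_of_not_preconnected_induce hGc (by rwa [compl_compl]) hWc
        exact pathGraph_four_isIndContained_compl.trans
          (compl_compl G ▸ compl_isIndContained_compl.2 hN)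
    · exact pathGraph_four_isIndContained_of_not_preconnected_induce hG hGc hW

end Seinsche

/-! ### Double posets -/

namespace DoublePoset

variable {P Q R : DoublePoset}

/-- The map `f` embeds `P` as a double subposet of `Q`; see `IsEmb.injective`. -/
def IsEmb (P Q : DoublePoset) (f : P.carrier → Q.carrier) : Prop :=
  ∀ x y, (P.le₁ x y ↔ Q.le₁ (f x) (f y)) ∧ (P.le₂ x y ↔ Q.le₂ (f x) (f y))

theorem IsEmb.injective {f : P.carrier → Q.carrier} (hf : IsEmb P Q f) :
    Function.Injective f := fun x y h => by
  have := P.po₁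
  have := Q.po₁
  exact antisymm_of P.le₁ ((hf x y).1.2 (h ▸ refl_of Q.le₁ _)) ((hf y x).1.2 (h ▸ refl_of Q.le₁ _))

theorem IsEmb.contains {f : P.carrier → Q.carrier} (hf : IsEmb P Q f) (h : P.Contains R) :
    Q.Contains R := by
  obtain ⟨g, hg, h⟩ := contains_iff.1 h
  exact contains_iff.2 ⟨f ∘ g, hf.injective.comp hg, fun x y =>
    ⟨(h x y).1.trans (hf _ _).1, (h x y).2.trans (hf _ _).2⟩⟩

theorem IsEmb.isPlane {f : P.carrier → Q.carrier} (hf : IsEmb P Q f) (hQ : Q.IsPlane) :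
    P.IsPlane := fun x y hxy => by
  rw [(hf x y).1, (hf y x).1, (hf x y).2, (hf y x).2]
  exact hQ _ _ (hf.injective.ne hxy)

theorem IsEmb.isWN {f : P.carrier → Q.carrier} (hf : IsEmb P Q f) (hQ : Q.IsWN) : P.IsWN :=
  ⟨hf.isPlane hQ.1, fun h => hQ.2.1 (hf.contains h), fun h => hQ.2.2 (hf.contains h)⟩

theorem isEmb_val (P : DoublePoset) (I : Set P.carrier) :
    IsEmb (P.restrict I) P Subtype.val := fun _ _ => ⟨Iff.rfl, Iff.rfl⟩

theorem isEmb_inl (P Q : DoublePoset) : IsEmb P (P.prod Q) Sum.inl := fun x y => by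
  simp [prod]

theorem isEmb_inr (P Q : DoublePoset) : IsEmb Q (P.prod Q) Sum.inr := fun x y => by
  simp [prod]

theorem IsWN.restrict (hP : P.IsWN) (I : Set P.carrier) : (P.restrict I).IsWN :=
  (isEmb_val P I).isWN hP

/-- The double poset obtained by exchanging the two orders. -/
def swap (P : DoublePoset) : DoublePoset where
  carrier := P.carrier
  finite := P.finite
  le₁ := P.le₂
  le₂ := P.le₁
  po₁ := P.po₂
  po₂ := P.po₁

theorem Iso.swap : Iso P Q → Iso P.swap Q.swap := fun ⟨e, he⟩ => ⟨e, fun x y => (he x y).symm⟩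

theorem Contains.swap (h : P.Contains Q) : P.swap.Contains Q.swap := by
  obtain ⟨I, hI⟩ := h
  exact ⟨I, hI.swap⟩

theorem Contains.congr (h : P.Contains Q) (e : Iso Q R) : P.Contains R := by
  obtain ⟨I, hI⟩ := h
  exact ⟨I, e.symm.trans hI⟩

theorem iso_swap_posetN : Iso posetN.swap posetN' := by
  let e : Fin 4 ≃ Fin 4 := Equiv.swap 1 2
  have he : ∀ x y : Fin 4,
      (listRel [(0, 1), (2, 1), (2, 3)] x y ↔ listRel [(0, 2), (1, 2), (1, 3)] (e x) (e y)) ∧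
      (listRel [(0, 2), (0, 3), (1, 3)] x y ↔ listRel [(0, 1), (0, 3), (2, 3)] (e x) (e y)) := by
    decide
  exact ⟨e, he⟩

theorem IsPlane.swap (hP : P.IsPlane) : P.swap.IsPlane := fun x y hxy => by
  have := hP x y hxy
  simp only [DoublePoset.swap]
  tauto

theorem IsWN.swap (hP : P.IsWN) : P.swap.IsWN :=
  ⟨hP.1.swap, fun h => hP.2.2 (h.swap.congr iso_swap_posetN),
    fun h => hP.2.1 (h.swap.congr iso_swap_posetN.symm.swap)⟩

theorem IsPlane.total (hP : P.IsPlane) (x y : P.carrier) :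
    P.le₁ x y ∨ P.le₁ y x ∨ P.le₂ x y ∨ P.le₂ y x := by
  have := P.po₁
  rcases eq_or_ne x y with rfl | h
  · exact .inl (refl_of P.le₁ x)
  · have := hP x y h
    tauto

theorem IsPlane.eq_of_le (hP : P.IsPlane) {x y : P.carrier} (h₁ : P.le₁ x y ∨ P.le₁ y x)
    (h₂ : P.le₂ x y ∨ P.le₂ y x) : x = y := by
  by_contra h
  exact (hP x y h).1 h₁ h₂

theorem IsPlane.le_of_le₁_of_le₂ (hP : P.IsPlane) {x y z : P.carrier} (hxy : P.le₁ x y)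
    (hyz : P.le₂ y z) : P.le₁ x z ∨ P.le₂ x z := by
  have := P.po₁
  have := P.po₂
  rcases hP.total x z with hxz | hzx | hxz | hzx
  · exact .inl hxz
  · exact .inl (hP.eq_of_le (.inr (trans_of P.le₁ hzx hxy)) (.inl hyz) ▸ hxy)
  · exact .inr hxz
  · exact .inr (hP.eq_of_le (.inl hxy) (.inr (trans_of P.le₂ hyz hzx)) ▸ hyz)

theorem IsPlane.le_or_le_trans (hP : P.IsPlane) {x y z : P.carrier}
    (hxy : P.le₁ x y ∨ P.le₂ x y) (hyz : P.le₁ y z ∨ P.le₂ y z) : P.le₁ x z ∨ P.le₂ x z := by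
  have := P.po₁
  have := P.po₂
  rcases hxy, hyz with ⟨hxy | hxy, hyz | hyz⟩
  · exact .inl (trans_of P.le₁ hxy hyz)
  · exact hP.le_of_le₁_of_le₂ hxy hyz
  · exact (hP.swap.le_of_le₁_of_le₂ hxy hyz).symm
  · exact .inr (trans_of P.le₂ hxy hyz)

theorem IsPlane.exists_forall_le_or_le (hP : P.IsPlane) [Nonempty P.carrier] :
    ∃ m : P.carrier, ∀ x, P.le₁ m x ∨ P.le₂ m x := by
  have := P.po₁
  have := P.finite
  let ge : P.carrier → P.carrier → Prop := fun x y => P.le₁ y x ∨ P.le₂ y x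
  have : IsTrans P.carrier ge := ⟨fun _ _ _ h h' => hP.le_or_le_trans h' h⟩
  have hdir : Directed ge id := fun x y => by
    rcases hP.total x y with h | h | h | h
    · exact ⟨x, .inl (refl_of P.le₁ x), .inl h⟩
    · exact ⟨y, .inl h, .inl (refl_of P.le₁ y)⟩
    · exact ⟨x, .inl (refl_of P.le₁ x), .inr h⟩
    · exact ⟨y, .inr h, .inl (refl_of P.le₁ y)⟩
  exact hdir.finite_le id

/-- The subset `A` is the left factor of a decomposition of `P` as a product. -/
def IsCut (P : DoublePoset) (A : Set P.carrier) : Prop := ∀ x ∈ A, ∀ y ∉ A, P.le₂ x y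

theorem IsCut.subset_total {A B : Set P.carrier} (hA : P.IsCut A) (hB : P.IsCut B) :
    A ⊆ B ∨ B ⊆ A := by
  have := P.po₂
  by_contra! h
  obtain ⟨x, hxA, hxB⟩ := Set.not_subset.1 h.1
  obtain ⟨y, hyB, hyA⟩ := Set.not_subset.1 h.2
  exact hyA (antisymm_of P.le₂ (hA x hxA y hyA) (hB y hyB x hxB) ▸ hxA)

theorem IsPlane.exists_isCut (hP : P.IsPlane) [Nonempty P.carrier] (h : ¬ P.HConnected) :
    ∃ A, P.IsCut A ∧ A.Nonempty ∧ Aᶜ.Nonempty := by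
  have := P.po₂
  let r : P.carrier → P.carrier → Prop := fun a b => P.le₁ a b ∨ P.le₁ b a
  have : Std.Symm r := ⟨fun _ _ => Or.symm⟩
  obtain ⟨m, hm⟩ := hP.exists_forall_le_or_le
  refine ⟨{x | Relation.ReflTransGen r m x}, fun x hx y hy => ?_, ⟨m, .refl⟩, ?_⟩
  · induction hx with
    | refl => exact (hm y).resolve_left fun h => hy (.single (.inl h))
    | @tail b c hb hbc ih =>
      rcases hP.total c y with h | h | h | h
      · exact (hy ((hb.tail hbc).tail (.inl h))).elim
      · exact (hy ((hb.tail hbc).tail (.inr h))).elim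
      · exact h
      · exact hP.eq_of_le hbc (.inl (trans_of P.le₂ ih h)) ▸ ih
  · by_contra! hempty
    have hmem : ∀ z, Relation.ReflTransGen r m z := Set.eq_univ_iff_forall.1
      (Set.compl_empty_iff.1 hempty)
    exact h ⟨‹_›, fun x y =>
      (Std.Symm.symm (r := Relation.ReflTransGen r) _ _ (hmem x)).trans (hmem y)⟩

theorem IsPlane.isEmb_of_monotone (hP : P.IsPlane) (hQ : Q.IsPlane) {f : P.carrier → Q.carrier}
    (hf : Function.Injective f) (hf₁ : ∀ x y, P.le₁ x y → Q.le₁ (f x) (f y))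
    (hf₂ : ∀ x y, P.le₂ x y → Q.le₂ (f x) (f y)) : IsEmb P Q f := by
  have := P.po₁
  have := P.po₂
  have := Q.po₁
  have := Q.po₂
  refine fun x y => ⟨⟨hf₁ x y, fun h => ?_⟩, ⟨hf₂ x y, fun h => ?_⟩⟩
  · rcases hP.total x y with h' | h' | h' | h'
    · exact h'
    · exact hf (antisymm_of Q.le₁ h (hf₁ y x h')) ▸ refl_of P.le₁ x
    · exact hf (hQ.eq_of_le (.inl h) (.inl (hf₂ x y h'))) ▸ refl_of P.le₁ x
    · exact hf (hQ.eq_of_le (.inl h) (.inr (hf₂ y x h'))) ▸ refl_of P.le₁ x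
  · rcases hP.total x y with h' | h' | h' | h'
    · exact hf (hQ.eq_of_le (.inl (hf₁ x y h')) (.inl h)) ▸ refl_of P.le₂ x
    · exact hf (hQ.eq_of_le (.inr (hf₁ y x h')) (.inl h)) ▸ refl_of P.le₂ x
    · exact h'
    · exact hf (antisymm_of Q.le₂ h (hf₂ y x h')) ▸ refl_of P.le₂ x

theorem isPlane_posetN : posetN.IsPlane := by
  have h : ∀ x y : Fin 4, x ≠ y →
      ((listRel [(0, 2), (0, 3), (1, 3)] x y ∨ listRel [(0, 2), (0, 3), (1, 3)] y x) ↔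
        ¬ (listRel [(0, 1), (2, 1), (2, 3)] x y ∨ listRel [(0, 1), (2, 1), (2, 3)] y x)) := by
    decide
  exact h

theorem rel_of_listRel {α : Type*} {r : α → α → Prop} (hr : ∀ x, r x x) {f : Fin 4 → α}
    {l : List (Fin 4 × Fin 4)} (hl : ∀ p ∈ l, r (f p.1) (f p.2)) {i j : Fin 4}
    (h : listRel l i j) : r (f i) (f j) := by
  rcases h with rfl | h
  · exact hr _
  · exact hl _ h

theorem IsPlane.contains_posetN (hP : P.IsPlane) {f : Fin 4 → P.carrier}
    (hf : Function.Injective f)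
    (h₁ : ∀ p ∈ [((0 : Fin 4), (2 : Fin 4)), (0, 3), (1, 3)], P.le₁ (f p.1) (f p.2))
    (h₂ : ∀ p ∈ [((0 : Fin 4), (1 : Fin 4)), (2, 1), (2, 3)], P.le₂ (f p.1) (f p.2)) :
    P.Contains posetN := by
  have := P.po₁
  have := P.po₂
  have hemb : IsEmb posetN P f := isPlane_posetN.isEmb_of_monotone hP hf
    (fun _ _ => rel_of_listRel (refl_of P.le₁) h₁) (fun _ _ => rel_of_listRel (refl_of P.le₂) h₂)
  exact contains_iff.2 ⟨f, hf, hemb⟩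

theorem IsPlane.contains_posetN' (hP : P.IsPlane) {f : Fin 4 → P.carrier}
    (hf : Function.Injective f)
    (h₁ : ∀ p ∈ [((0 : Fin 4), (2 : Fin 4)), (1, 2), (1, 3)], P.le₁ (f p.1) (f p.2))
    (h₂ : ∀ p ∈ [((0 : Fin 4), (1 : Fin 4)), (0, 3), (2, 3)], P.le₂ (f p.1) (f p.2)) :
    P.Contains posetN' := by
  have hσ : Function.Injective ![(0 : Fin 4), 2, 1, 3] := by decide
  have h := hP.swap.contains_posetN (hf.comp hσ)
    (by simpa [DoublePoset.swap] using h₂) (by simpa [DoublePoset.swap] using h₁)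
  exact h.swap.congr iso_swap_posetN

section Comparability

open SimpleGraph

theorem HConnected.preconnected (h : P.HConnected) : (fromRel P.le₁).Preconnected := fun x y => by
  rw [reachable_iff_reflTransGen]
  refine (h.2 x y).lift' id fun a b hab => ?_
  rcases eq_or_ne a b with rfl | hne
  · exact .refl
  · exact .single ((fromRel_adj _ _ _).2 ⟨hne, hab⟩)

theorem IsPlane.compl_fromRel (hP : P.IsPlane) : (fromRel P.le₁)ᶜ = fromRel P.le₂ := by
  ext x y
  have := hP x y
  simp only [compl_adj, fromRel_adj]
  tauto

/-- A path `a - b - c - d` for `≤₁` with `a <₁ b` is a zigzag `a <₁ b >₁ c <₁ d`; the direction in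
which `≤₂` compares `a` and `c` propagates to `(a, d)` and `(b, d)`. -/
theorem IsPlane.contains_of_path (hP : P.IsPlane) {f : Fin 4 → P.carrier}
    (hf : Function.Injective f) (h01 : P.le₁ (f 0) (f 1))
    (h12 : P.le₁ (f 1) (f 2) ∨ P.le₁ (f 2) (f 1)) (h23 : P.le₁ (f 2) (f 3) ∨ P.le₁ (f 3) (f 2))
    (h02 : P.le₂ (f 0) (f 2) ∨ P.le₂ (f 2) (f 0)) (h03 : P.le₂ (f 0) (f 3) ∨ P.le₂ (f 3) (f 0))
    (h13 : P.le₂ (f 1) (f 3) ∨ P.le₂ (f 3) (f 1)) :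
    P.Contains posetN ∨ P.Contains posetN' := by
  have := P.po₁
  have := P.po₂
  have h21 : P.le₁ (f 2) (f 1) := h12.resolve_left fun h =>
    hf.ne (by decide) (hP.eq_of_le (.inl (trans_of P.le₁ h01 h)) h02)
  have h23 : P.le₁ (f 2) (f 3) := h23.resolve_right fun h =>
    hf.ne (by decide) (hP.eq_of_le (.inr (trans_of P.le₁ h h21)) h13)
  rcases h02 with h02 | h20
  · have h03 : P.le₂ (f 0) (f 3) := h03.resolve_right fun h =>
      hf.ne (by decide) (hP.eq_of_le (.inl h23) (.inr (trans_of P.le₂ h h02)))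
    have h13 : P.le₂ (f 1) (f 3) := h13.resolve_right fun h =>
      hf.ne (by decide) (hP.eq_of_le (.inl h01) (.inl (trans_of P.le₂ h03 h)))
    have hσ : Function.Injective ![(0 : Fin 4), 2, 1, 3] := by decide
    exact .inr (hP.contains_posetN' (hf.comp hσ) (by simp [h01, h21, h23])
      (by simp [h02, h03, h13]))
  · have h30 : P.le₂ (f 3) (f 0) := h03.resolve_left fun h =>
      hf.ne (by decide) (hP.eq_of_le (.inl h23) (.inl (trans_of P.le₂ h20 h)))
    have h31 : P.le₂ (f 3) (f 1) := h13.resolve_left fun h =>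
      hf.ne (by decide) (hP.eq_of_le (.inl h01) (.inr (trans_of P.le₂ h h30)))
    have hσ : Function.Injective ![(2 : Fin 4), 0, 3, 1] := by decide
    exact .inl (hP.contains_posetN (hf.comp hσ) (by simp [h01, h21, h23])
      (by simp [h20, h30, h31]))

theorem IsPlane.contains_of_pathGraph_isIndContained (hP : P.IsPlane)
    (h : pathGraph 4 ⊴ fromRel P.le₁) : P.Contains posetN ∨ P.Contains posetN' := by
  have := P.po₁
  obtain ⟨f⟩ := h
  have h₁ : ∀ i j, (pathGraph 4).Adj i j → P.le₁ (f i) (f j) ∨ P.le₁ (f j) (f i) := fun i j h =>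
    ((fromRel_adj _ _ _).1 (f.map_adj_iff.2 h)).2
  have h₂ : ∀ i j, i ≠ j → ¬ (pathGraph 4).Adj i j → P.le₂ (f i) (f j) ∨ P.le₂ (f j) (f i) := by
    intro i j hij h
    have hcompl : (fromRel P.le₁)ᶜ.Adj (f i) (f j) :=
      (compl_adj _ _ _).2 ⟨f.injective.ne hij, mt f.map_adj_iff.1 h⟩
    rw [hP.compl_fromRel, fromRel_adj] at hcompl
    exact hcompl.2
  have h01 := h₁ 0 1 (by simp [pathGraph_adj])
  have h12 := h₁ 1 2 (by simp [pathGraph_adj])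
  have h23 := h₁ 2 3 (by simp [pathGraph_adj])
  have h02 := h₂ 0 2 (by decide) (by simp [pathGraph_adj])
  have h03 := h₂ 0 3 (by decide) (by simp [pathGraph_adj])
  have h13 := h₂ 1 3 (by decide) (by simp [pathGraph_adj])
  rcases h01 with h01 | h10
  · exact hP.contains_of_path f.injective h01 h12 h23 h02 h03 h13
  · have h12 : P.le₁ (f 1) (f 2) := h12.resolve_right fun h =>
      f.injective.ne (by decide) (hP.eq_of_le (.inr (trans_of P.le₁ h h10)) h02)
    have h32 : P.le₁ (f 3) (f 2) := h23.resolve_left fun h =>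
      f.injective.ne (by decide) (hP.eq_of_le (.inl (trans_of P.le₁ h12 h)) h13)
    exact hP.contains_of_path (f := f ∘ Fin.rev) (f.injective.comp Fin.rev_injective) h32 (.inr h12)
      (.inl h10) h13.symm h03.symm h02.symm

theorem IsWN.subsingleton_of_hConnected (hP : P.IsWN) (h₁ : P.HConnected)
    (h₂ : P.swap.HConnected) : Subsingleton P.carrier := by
  have := P.finite
  by_contra h
  have := not_subsingleton_iff_nontrivial.1 h
  have hpath : pathGraph 4 ⊴ fromRel P.le₁ := pathGraph_four_isIndContained_of_preconnected
    h₁.preconnected (hP.1.compl_fromRel ▸ h₂.preconnected)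
  exact (hP.1.contains_of_pathGraph_isIndContained hpath).elim hP.2.1 hP.2.2

end Comparability

end DoublePoset

/-! ### Isoclasses of WN posets -/

namespace WNP

open DoublePoset

/-- The isoclass of the double subposet of `P` on `I`. -/
def sub (P : DoublePoset) (hP : P.IsWN) (I : Set P.carrier) : WNP :=
  mk (P.restrict I) (hP.restrict I)

section Sub

variable {P Q : DoublePoset} (hP : P.IsWN) (hQ : Q.IsWN)

theorem sub_univ : sub P hP Set.univ = mk P hP :=
  mk_eq_mk.2 ⟨Equiv.Set.univ _, fun _ _ => ⟨Iff.rfl, Iff.rfl⟩⟩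

theorem sub_image {f : P.carrier → Q.carrier} (hf : IsEmb P Q f) (I : Set P.carrier) :
    sub Q hQ (f '' I) = sub P hP I :=
  mk_eq_mk.2 (Iso.symm ⟨Equiv.Set.image f I hf.injective, fun x y => hf x.1 y.1⟩)

theorem sub_range {f : P.carrier → Q.carrier} (hf : IsEmb P Q f) :
    sub Q hQ (Set.range f) = mk P hP := by
  rw [← Set.image_univ, sub_image hP hQ hf, sub_univ]

theorem sub_union {A B : Set P.carrier} (hd : Disjoint A B)
    (h : ∀ x ∈ A, ∀ y ∈ B, P.le₂ x y) : sub P hP (A ∪ B) = sub P hP A * sub P hP B := by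
  classical
  refine mk_eq_mk.2 (Iso.symm ⟨(Equiv.Set.union hd).symm, ?_⟩)
  refine ((hP.restrict A).prod (hP.restrict B)).1.isEmb_of_monotone (hP.restrict (A ∪ B)).1
    (Equiv.Set.union hd).symm.injective ?_ ?_
  · rintro _ _ (⟨hxy⟩ | ⟨hxy⟩) <;> exact hxy
  · rintro _ _ (hxy | hxy | ⟨x, y⟩)
    · exact hxy
    · exact hxy
    · exact h x.1 x.2 y.1 y.2

theorem card_sub (I : Set P.carrier) : (sub P hP I).card = I.ncard := by
  obtain ⟨e, -⟩ := rep_mk (P.restrict I) (hP.restrict I)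
  exact Nat.card_congr e

end Sub

theorem sub_rep_univ (P : WNP) : sub P.rep P.rep_isWN Set.univ = P := by
  rw [sub_univ, mk_rep]

theorem card_one : (1 : WNP).card = 0 := by
  have := card_mul 1 1
  rw [mul_one] at this
  lia

theorem card_eq_zero {P : WNP} : P.card = 0 ↔ P = 1 := by
  refine ⟨fun h => ?_, fun h => h ▸ card_one⟩
  have := P.rep.finite
  exact eq_one_of_isEmpty (Finite.card_eq_zero_iff.1 h)

theorem sub_eq_one {P : DoublePoset} {hP : P.IsWN} {I : Set P.carrier} :
    sub P hP I = 1 ↔ I = ∅ := by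
  have := P.finite
  rw [← card_eq_zero, card_sub, Set.ncard_eq_zero]

theorem mul_eq_one {P Q : WNP} : P * Q = 1 ↔ P = 1 ∧ Q = 1 := by
  rw [← card_eq_zero, ← card_eq_zero, ← card_eq_zero, card_mul, Nat.add_eq_zero_iff]

section Cut

variable {P : DoublePoset} (hP : P.IsWN) {A B : Set P.carrier}

theorem sub_inter_mul_sub_sdiff (hA : P.IsCut A) (B : Set P.carrier) :
    sub P hP (B ∩ A) * sub P hP (B \ A) = sub P hP B := by
  rw [← sub_union hP Set.disjoint_sdiff_inter.symm fun x hx y hy => hA x hx.2 y hy.2,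
    Set.inter_union_sdiff]

theorem sub_mul_sub_sdiff (hA : P.IsCut A) (hAB : A ⊆ B) :
    sub P hP A * sub P hP (B \ A) = sub P hP B := by
  rw [← sub_inter_mul_sub_sdiff hP hA B, Set.inter_eq_right.2 hAB]

theorem sub_mul_sub_compl (hA : P.IsCut A) : sub P hP A * sub P hP Aᶜ = mk P hP := by
  rw [← sub_univ, ← sub_mul_sub_sdiff hP hA (Set.subset_univ A), Set.compl_eq_univ_sdiff]

theorem sub_sdiff_mul_sub_compl (hB : P.IsCut B) (hAB : A ⊆ B) :
    sub P hP (B \ A) * sub P hP Bᶜ = sub P hP Aᶜ := by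
  rw [← sub_inter_mul_sub_sdiff hP hB Aᶜ, Set.inter_comm, Set.sdiff_eq (s := Aᶜ),
    Set.inter_eq_right.2 (Set.compl_subset_compl.2 hAB), Set.sdiff_eq]

theorem exists_isCut_of_mul_eq {Q R : WNP} (h : Q * R = mk P hP) :
    ∃ A, P.IsCut A ∧ sub P hP A = Q ∧ sub P hP Aᶜ = R := by
  obtain ⟨(e : Q.rep.carrier ⊕ R.rep.carrier ≃ P.carrier), he⟩ :=
    (mul_rep Q R).symm.trans (h ▸ rep_mk P hP)
  have hinl : IsEmb Q.rep P (e ∘ Sum.inl) := fun x y =>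
    ⟨(isEmb_inl _ R.rep x y).1.trans (he _ _).1, (isEmb_inl _ R.rep x y).2.trans (he _ _).2⟩
  have hinr : IsEmb R.rep P (e ∘ Sum.inr) := fun x y =>
    ⟨(isEmb_inr Q.rep _ x y).1.trans (he _ _).1, (isEmb_inr Q.rep _ x y).2.trans (he _ _).2⟩
  have hcompl : (Set.range (e ∘ Sum.inl))ᶜ = Set.range (e ∘ Sum.inr) := by
    rw [Set.range_comp, Set.range_comp, ← Set.image_compl_eq e.bijective, Set.compl_range_inl]
  refine ⟨Set.range (e ∘ Sum.inl), ?_, ?_, ?_⟩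
  · rintro _ ⟨x, rfl⟩ y hy
    obtain ⟨z, rfl⟩ : y ∈ Set.range (e ∘ Sum.inr) := hcompl ▸ hy
    exact (he _ _).2.1 (Sum.Lex.sep _ _)
  · rw [sub_range Q.rep_isWN hP hinl, mk_rep]
  · rw [hcompl, sub_range R.rep_isWN hP hinr, mk_rep]

end Cut

theorem exists_isCut (Q R : WNP) : ∃ (P : DoublePoset) (hP : P.IsWN) (A : Set P.carrier),
    P.IsCut A ∧ sub P hP A = Q ∧ sub P hP Aᶜ = R :=
  ⟨_, rep_isWN (Q * R), exists_isCut_of_mul_eq _ (mk_rep _).symm⟩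

/-- Levi's lemma. -/
theorem exists_mul_or_mul_of_mul_eq_mul {Q R Q' R' : WNP} (h : Q * R = Q' * R') :
    ∃ T, (Q' = Q * T ∧ R = T * R') ∨ (Q = Q' * T ∧ R' = T * R) := by
  obtain ⟨P, hP, A, hA, rfl, rfl⟩ := exists_isCut Q R
  obtain ⟨B, hB, rfl, rfl⟩ := exists_isCut_of_mul_eq hP (h.symm.trans (sub_mul_sub_compl hP hA))
  rcases hA.subset_total hB with hAB | hBA
  · exact ⟨_, .inl ⟨(sub_mul_sub_sdiff _ hA hAB).symm, (sub_sdiff_mul_sub_compl _ hB hAB).symm⟩⟩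
  · exact ⟨_, .inr ⟨(sub_mul_sub_sdiff _ hB hBA).symm, (sub_sdiff_mul_sub_compl _ hA hBA).symm⟩⟩

theorem exists_mul_of_not_hConnected {P : WNP} (h1 : P ≠ 1) (h : ¬ P.HConnected) :
    ∃ Q R, Q ≠ 1 ∧ R ≠ 1 ∧ P = Q * R := by
  have : Nonempty P.rep.carrier := not_isEmpty_iff.1 (mt eq_one_of_isEmpty h1)
  obtain ⟨A, hcut, hA, hA'⟩ := P.rep_isWN.1.exists_isCut h
  refine ⟨sub _ P.rep_isWN A, sub _ P.rep_isWN Aᶜ, mt sub_eq_one.1 hA.ne_empty,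
    mt sub_eq_one.1 hA'.ne_empty, ?_⟩
  rw [sub_mul_sub_compl _ hcut, mk_rep]

theorem exists_hConnected_mul {P : WNP} (h1 : P ≠ 1) :
    ∃ Q R, Q.HConnected ∧ P = Q * R := by
  induction hn : P.card using Nat.strong_induction_on generalizing P with
  | _ n ih =>
    by_cases h : P.HConnected
    · exact ⟨P, 1, h, (mul_one P).symm⟩
    · obtain ⟨Q, R, hQ, hR, rfl⟩ := exists_mul_of_not_hConnected h1 h
      have hR' := mt card_eq_zero.1 hR
      obtain ⟨Q', R', hQ', rfl⟩ := ih Q.card (by rw [← hn, card_mul]; lia) hQ rfl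
      exact ⟨Q', R' * R, hQ', mul_assoc _ _ _⟩

noncomputable instance : IsLeftCancelMul WNP where
  mul_left_cancel Q R R' h := by
    obtain ⟨T, ⟨hQ, hR⟩ | ⟨hQ, hR⟩⟩ := exists_mul_or_mul_of_mul_eq_mul h <;>
    · have hcard := congrArg card hQ
      rw [card_mul] at hcard
      simp [hR, card_eq_zero.1 (show T.card = 0 by lia)]

theorem hConnected_mul_inj {Q Q' R R' : WNP} (hQ : Q.HConnected) (hQ' : Q'.HConnected)
    (h : Q * R = Q' * R') : Q = Q' ∧ R = R' := by
  suffices Q = Q' by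
    subst this
    exact ⟨rfl, mul_left_cancel h⟩
  obtain ⟨T, ⟨h1, -⟩ | ⟨h1, -⟩⟩ := exists_mul_or_mul_of_mul_eq_mul h
  · rcases (mul_eq_iff_of_hConnected hQ').1 h1.symm with ⟨h, -⟩ | ⟨h, -⟩
    exacts [h, (ne_one_of_hConnected hQ h).elim]
  · rcases (mul_eq_iff_of_hConnected hQ).1 h1.symm with ⟨h, -⟩ | ⟨h, -⟩
    exacts [h.symm, (ne_one_of_hConnected hQ' h).elim]

/-- The isoclass obtained by exchanging the two orders. -/
noncomputable def swap (P : WNP) : WNP := mk P.rep.swap P.rep_isWN.swap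

theorem swap_mk (P : DoublePoset) (hP : P.IsWN) : swap (mk P hP) = mk P.swap hP.swap :=
  mk_eq_mk.2 (rep_mk P hP).swap

@[simp] theorem swap_swap (P : WNP) : P.swap.swap = P := by
  conv_rhs => rw [← mk_rep P]
  exact swap_mk _ _

theorem swap_injective : Function.Injective swap :=
  Function.Involutive.injective swap_swap

@[simp] theorem card_swap (P : WNP) : P.swap.card = P.card := by
  obtain ⟨e, -⟩ := rep_mk P.rep.swap P.rep_isWN.swap
  exact Nat.card_congr e

@[simp] theorem swap_eq_one {P : WNP} : P.swap = 1 ↔ P = 1 := by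
  rw [← card_eq_zero, card_swap, card_eq_zero]

/-- The product exchanged by `swap`: `stack P Q` is the disjoint union of `P` and `Q`, where
`x ≤₁ y` and `x, y` are not comparable for `≤₂` whenever `x ∈ P` and `y ∈ Q`. -/
noncomputable def stack (P Q : WNP) : WNP := swap (P.swap * Q.swap)

theorem swap_stack (P Q : WNP) : swap (stack P Q) = P.swap * Q.swap := swap_swap _

theorem card_stack (P Q : WNP) : (stack P Q).card = P.card + Q.card := by
  rw [stack, card_swap, card_mul, card_swap, card_swap]

@[simp] theorem stack_one (P : WNP) : stack P 1 = P := by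
  rw [stack, swap_eq_one.2 rfl, mul_one, swap_swap]

/-- Connectedness for the second order. -/
def RConnected (P : WNP) : Prop := P.swap.HConnected

theorem exists_rConnected_stack {P : WNP} (h1 : P ≠ 1) :
    ∃ Q R, Q.RConnected ∧ P = stack Q R := by
  obtain ⟨Q, R, hQ, h⟩ := exists_hConnected_mul (mt swap_eq_one.1 h1)
  refine ⟨Q.swap, R.swap, by rwa [RConnected, swap_swap], swap_injective ?_⟩
  rw [h, swap_stack, swap_swap, swap_swap]

theorem rConnected_stack_inj {Q Q' R R' : WNP} (hQ : Q.RConnected) (hQ' : Q'.RConnected)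
    (h : stack Q R = stack Q' R') : Q = Q' ∧ R = R' := by
  have := hConnected_mul_inj hQ hQ' (swap_injective h)
  exact ⟨swap_injective this.1, swap_injective this.2⟩

theorem ne_one_of_rConnected {P : WNP} (hP : P.RConnected) : P ≠ 1 := fun h =>
  ne_one_of_hConnected hP (swap_eq_one.2 h)

theorem eq_point_of_card_eq_one {P : WNP} (h : P.card = 1) : P = point := by
  have := P.rep.po₁
  have := P.rep.po₂
  obtain ⟨hs, ⟨x⟩⟩ := Nat.card_eq_one_iff_unique.1 h
  rw [← mk_rep P]
  refine mk_eq_mk.2 ⟨⟨fun _ => (), fun _ => x, fun y => Subsingleton.elim _ _, fun _ => rfl⟩,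
    fun y z => ?_⟩
  rw [Subsingleton.elim y z]
  exact ⟨iff_of_true (refl_of P.rep.le₁ z) trivial, iff_of_true (refl_of P.rep.le₂ z) trivial⟩

theorem card_point : point.card = 1 := by
  rw [point, ← sub_univ, card_sub, Set.ncard_univ]
  exact Nat.card_unique (α := Unit)

theorem eq_point_of_hConnected_of_rConnected {P : WNP} (hP : P.HConnected)
    (hP' : P.RConnected) : P = point := by
  have := P.rep_isWN.subsingleton_of_hConnected hP ((rep_mk _ _).hConnected hP')
  exact eq_point_of_card_eq_one (Nat.card_eq_one_iff_unique.2 ⟨this, hP.1⟩)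

end WNP

/-! ### Sums over ideals -/

namespace DoublePoset

variable {P Q : DoublePoset}

theorem val_image_univ (P : DoublePoset) (C : Set P.carrier) :
    (Subtype.val : (P.restrict C).carrier → P.carrier) '' Set.univ = C := by
  rw [Set.image_univ]
  exact Subtype.range_val

/-- The ideals of the double subposet of `P` on `C`, as subsets of `P`. -/
noncomputable def ideals (P : DoublePoset) (C : Set P.carrier) : Finset (Set P.carrier) :=
  haveI := P.finite
  (Set.toFinite {J | J ⊆ C ∧ ∀ x ∈ J, ∀ y ∈ C, P.le₁ x y → y ∈ J}).toFinset

section Ideals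

variable {A C D J L : Set P.carrier}

theorem mem_ideals : J ∈ P.ideals C ↔ J ⊆ C ∧ ∀ x ∈ J, ∀ y ∈ C, P.le₁ x y → y ∈ J := by
  simp [ideals]

theorem mem_ideals_univ : J ∈ P.ideals Set.univ ↔ P.IsIdeal J := by
  simp [mem_ideals, IsIdeal]

theorem empty_mem_ideals : ∅ ∈ P.ideals C :=
  mem_ideals.2 ⟨Set.empty_subset _, fun _ h => h.elim⟩

theorem self_mem_ideals : C ∈ P.ideals C :=
  mem_ideals.2 ⟨subset_rfl, fun _ _ _ h _ => h⟩

theorem image_mem_ideals {g : P.carrier → Q.carrier} (hg : IsEmb P Q g) (hJ : J ∈ P.ideals C) :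
    g '' J ∈ Q.ideals (g '' C) := by
  rw [mem_ideals] at hJ ⊢
  refine ⟨Set.image_mono hJ.1, ?_⟩
  rintro _ ⟨x, hx, rfl⟩ _ ⟨y, hy, rfl⟩ h
  exact ⟨y, hJ.2 x hx y hy ((hg x y).1.2 h), rfl⟩

theorem preimage_mem_ideals {g : P.carrier → Q.carrier} (hg : IsEmb P Q g) {J : Set Q.carrier}
    (hJ : J ∈ Q.ideals (g '' C)) : g ⁻¹' J ∈ P.ideals C := by
  rw [mem_ideals] at hJ ⊢
  refine ⟨fun x hx => ?_, fun x hx y hy h => hJ.2 _ hx _ ⟨y, hy, rfl⟩ ((hg x y).1.1 h)⟩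
  obtain ⟨y, hy, h⟩ := hJ.1 hx
  exact hg.injective h ▸ hy

theorem mem_ideals_of_subset (hJ : J ∈ P.ideals C) (hJD : J ⊆ D) (hDC : D ⊆ C) :
    J ∈ P.ideals D :=
  mem_ideals.2 ⟨hJD, fun x hx y hy => (mem_ideals.1 hJ).2 x hx y (hDC hy)⟩

theorem mem_ideals_trans (hJ : J ∈ P.ideals D) (hD : D ∈ P.ideals C) : J ∈ P.ideals C := by
  rw [mem_ideals] at *
  exact ⟨hJ.1.trans hD.1, fun x hx y hy h => hJ.2 x hx y (hD.2 x (hJ.1 hx) y hy h) h⟩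

theorem sdiff_mem_ideals (hD : D ∈ P.ideals C) (J : Set P.carrier) :
    D \ J ∈ P.ideals (C \ J) := by
  rw [mem_ideals] at *
  exact ⟨Set.sdiff_subset_sdiff_left hD.1, fun x hx y hy h => ⟨hD.2 x hx.1 y hy.1 h, hy.2⟩⟩

theorem union_mem_ideals (hJ : J ∈ P.ideals C) (hL : L ∈ P.ideals (C \ J)) :
    J ∪ L ∈ P.ideals C := by
  rw [mem_ideals] at *
  refine ⟨Set.union_subset hJ.1 (hL.1.trans Set.sdiff_subset), ?_⟩
  rintro x (hx | hx) y hy h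
  · exact .inl (hJ.2 x hx y hy h)
  · exact (em (y ∈ J)).imp_right fun hyJ => hL.2 x hx y ⟨hy, hyJ⟩ h

theorem IsCut.not_le₁ (hA : P.IsCut A) (hP : P.IsPlane) {x y : P.carrier} (hx : x ∈ A)
    (hy : y ∉ A) : ¬ P.le₁ x y ∧ ¬ P.le₁ y x :=
  not_or.1 fun h => hy (hP.eq_of_le h (.inl (hA x hx y hy)) ▸ hx)

theorem IsCut.union_mem_ideals (hA : P.IsCut A) (hP : P.IsPlane) (hJ : J ∈ P.ideals A)
    (hL : L ∈ P.ideals Aᶜ) : J ∪ L ∈ P.ideals Set.univ := by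
  rw [mem_ideals] at *
  refine ⟨Set.subset_univ _, ?_⟩
  rintro x (hx | hx) y - h <;> by_cases hy : y ∈ A
  · exact .inl (hJ.2 x hx y hy h)
  · exact ((hA.not_le₁ hP (hJ.1 hx) hy).1 h).elim
  · exact ((hA.not_le₁ hP hy (hL.1 hx)).2 h).elim
  · exact .inr (hL.2 x hx y hy h)

end Ideals

/-- The number of pairs `(x, y)` with `x ≤₁ y`, `x ∈ A` and `y ∈ B`. -/
noncomputable def relCard (P : DoublePoset) (A B : Set P.carrier) : ℕ :=
  {p ∈ A ×ˢ B | P.le₁ p.1 p.2}.ncard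

section RelCard

variable {A B : Set P.carrier}

theorem relCard_image {g : P.carrier → Q.carrier} (hg : IsEmb P Q g) (A B : Set P.carrier) :
    Q.relCard (g '' A) (g '' B) = P.relCard A B := by
  rw [relCard, relCard, ← Set.ncard_image_of_injective _ (hg.injective.prodMap hg.injective)]
  congr 1
  ext ⟨x, y⟩
  constructor
  · rintro ⟨⟨⟨a, ha, rfl⟩, b, hb, rfl⟩, h⟩
    exact ⟨(a, b), ⟨⟨ha, hb⟩, (hg a b).1.2 h⟩, rfl⟩
  · rintro ⟨⟨a, b⟩, ⟨⟨ha, hb⟩, h⟩, he⟩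
    cases he
    exact ⟨⟨⟨a, ha, rfl⟩, b, hb, rfl⟩, (hg a b).1.1 h⟩

theorem relCard_univ_left (A B : Set P.carrier) :
    P.relCard Set.univ B = P.relCard A B + P.relCard Aᶜ B := by
  have := P.finite
  rw [relCard, relCard, relCard, ← Set.ncard_union_eq]
  · congr 1
    ext p
    have := em (p.1 ∈ A)
    simp only [Set.mem_ofPred_eq, Set.mem_union, Set.mem_prod, Set.mem_univ, Set.mem_compl_iff]
    tauto
  · exact Set.disjoint_left.2 fun p hp hp' => hp'.1.1 hp.1.1

theorem relCard_univ_right (A B : Set P.carrier) :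
    P.relCard A Set.univ = P.relCard A B + P.relCard A Bᶜ := by
  have := P.finite
  rw [relCard, relCard, relCard, ← Set.ncard_union_eq]
  · congr 1
    ext p
    have := em (p.2 ∈ B)
    simp only [Set.mem_ofPred_eq, Set.mem_union, Set.mem_prod, Set.mem_univ, Set.mem_compl_iff]
    tauto
  · exact Set.disjoint_left.2 fun p hp hp' => hp'.1.2 hp.1.2

theorem relCard_le_mul : P.relCard A B ≤ A.ncard * B.ncard := by
  have := P.finite
  rw [← Set.ncard_prod]
  exact Set.ncard_le_ncard (Set.sep_subset _ _)

theorem relCard_eq_mul_iff :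
    P.relCard A B = A.ncard * B.ncard ↔ ∀ x ∈ A, ∀ y ∈ B, P.le₁ x y := by
  have := P.finite
  rw [← Set.ncard_prod]
  refine ⟨fun h x hx y hy => ?_, fun h => ?_⟩
  · have heq := Set.eq_of_subset_of_ncard_le (Set.sep_subset _ _) h.ge
    exact (Set.sep_eq_self_iff_mem_true.1 heq) (x, y) ⟨hx, hy⟩
  · rw [relCard, Set.sep_eq_self_iff_mem_true.2 fun p hp => h p.1 hp.1 p.2 hp.2]

theorem relCard_eq_zero (h : ∀ x ∈ A, ∀ y ∈ B, ¬ P.le₁ x y) : P.relCard A B = 0 := by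
  rw [relCard, Set.sep_eq_empty_iff_mem_false.2 fun p hp => h p.1 hp.1 p.2 hp.2, Set.ncard_empty]

end RelCard

end DoublePoset

namespace WNP

open DoublePoset

section IdealSum

variable {N : Type*} [AddCommMonoid N] (f : WNP → WNP → N)

/-- The sum of `f (C ∖ J) J` over the ideals `J` of the double subposet of `P` on `C`. -/
noncomputable def idealSumOn (P : DoublePoset) (hP : P.IsWN) (C : Set P.carrier)
    (f : WNP → WNP → N) : N :=
  ∑ J ∈ P.ideals C, f (sub P hP (C \ J)) (sub P hP J)

/-- The sum of `f (R ∖ I) I` over the ideals `I` of `R`. -/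
noncomputable def idealSum (R : WNP) (f : WNP → WNP → N) : N :=
  idealSumOn R.rep R.rep_isWN Set.univ f

theorem idealSumOn_image {P Q : DoublePoset} (hP : P.IsWN) (hQ : Q.IsWN)
    {g : P.carrier → Q.carrier} (hg : IsEmb P Q g) (C : Set P.carrier) :
    idealSumOn Q hQ (g '' C) f = idealSumOn P hP C f := by
  refine Finset.sum_nbij' (fun J => g ⁻¹' J) (fun J => g '' J)
    (fun J => preimage_mem_ideals hg) (fun J => image_mem_ideals hg) (fun J hJ => ?_)
    (fun J _ => Set.preimage_image_eq _ hg.injective) fun J hJ => ?_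
  all_goals have hJg : g '' (g ⁻¹' J) = J :=
    Set.image_preimage_eq_of_subset ((mem_ideals.1 hJ).1.trans (Set.image_subset_range _ _))
  · exact hJg
  · rw [← sub_image hP hQ hg, ← sub_image hP hQ hg, Set.image_sdiff hg.injective, hJg]

theorem idealSum_mk (P : DoublePoset) (hP : P.IsWN) :
    idealSum (mk P hP) f = idealSumOn P hP Set.univ f := by
  obtain ⟨e, he⟩ := rep_mk P hP
  rw [idealSum, ← idealSumOn_image f (mk P hP).rep_isWN hP he, Set.image_univ, e.range_eq_univ]

theorem idealSum_sub (P : DoublePoset) (hP : P.IsWN) (C : Set P.carrier) :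
    idealSum (sub P hP C) f = idealSumOn P hP C f :=
  (idealSum_mk f _ _).trans <| (idealSumOn_image f _ hP (isEmb_val P C) Set.univ).symm.trans <|
    congrArg (idealSumOn P hP · f) (val_image_univ P C)

theorem idealSumOn_univ_of_isCut {P : DoublePoset} (hP : P.IsWN) {A : Set P.carrier}
    (hA : P.IsCut A) : idealSumOn P hP Set.univ f =
      idealSumOn P hP A fun a b => idealSumOn P hP Aᶜ fun c d => f (a * c) (b * d) := by
  simp only [idealSumOn]
  rw [← Finset.sum_product']
  refine Finset.sum_nbij' (fun J => (J ∩ A, J \ A)) (fun J => J.1 ∪ J.2) ?_ ?_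
    (fun J _ => Set.inter_union_sdiff J A) ?_ ?_
  · intro J hJ
    have hAc := Set.compl_eq_univ_sdiff A ▸ sdiff_mem_ideals hJ A
    refine Finset.mem_product.2 ⟨mem_ideals.2 ⟨Set.inter_subset_right, fun x hx y hy h => ?_⟩, hAc⟩
    exact ⟨(mem_ideals.1 hJ).2 x hx.1 y trivial h, hy⟩
  · intro J hJ
    rw [Finset.mem_product] at hJ
    exact hA.union_mem_ideals hP.1 hJ.1 hJ.2
  · rintro ⟨J, L⟩ hJL
    rw [Finset.mem_product, mem_ideals, mem_ideals] at hJL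
    rw [Set.union_inter_distrib_right, Set.union_sdiff_distrib, Set.inter_eq_left.2 hJL.1.1,
      Set.sdiff_eq_empty.2 hJL.1.1, Set.empty_union, sdiff_eq_left.2
        (Set.disjoint_left.2 hJL.2.1), Set.disjoint_iff_inter_eq_empty.1
        (Set.disjoint_left.2 hJL.2.1), Set.union_empty]
  · intro J _
    rw [← sub_inter_mul_sub_sdiff hP hA (Set.univ \ J), ← sub_inter_mul_sub_sdiff hP hA J]
    congr 3 <;>
    · ext x
      simp only [Set.mem_inter_iff, Set.mem_sdiff, Set.mem_univ, Set.mem_compl_iff]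
      tauto

theorem idealSum_mul (Q R : WNP) :
    idealSum (Q * R) f = idealSum Q fun a b => idealSum R fun c d => f (a * c) (b * d) := by
  obtain ⟨P, hP, A, hA, rfl, rfl⟩ := exists_isCut Q R
  simp only [sub_mul_sub_compl hP hA, idealSum_mk, idealSum_sub, idealSumOn_univ_of_isCut f hP hA]

theorem idealSum_coassoc (R : WNP) (f : WNP → WNP → WNP → N) :
    (idealSum R fun s t => idealSum s fun a b => f a b t) =
      idealSum R fun s t => idealSum t fun a b => f s a b := by
  obtain ⟨P, hP, rfl⟩ : ∃ P hP, R = mk P hP := ⟨_, R.rep_isWN, (mk_rep R).symm⟩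
  simp only [idealSum_mk, idealSumOn, idealSum_sub]
  rw [Finset.sum_sigma', Finset.sum_sigma']
  refine Finset.sum_nbij' (fun J => ⟨J.1 ∪ J.2, J.1⟩) (fun D => ⟨D.2, D.1 \ D.2⟩) ?_ ?_ ?_ ?_ ?_
  · rintro ⟨J, L⟩ h
    rw [Finset.mem_sigma] at h ⊢
    exact ⟨union_mem_ideals h.1 h.2,
      mem_ideals_of_subset h.1 Set.subset_union_left (Set.subset_univ _)⟩
  · rintro ⟨D, J⟩ h
    rw [Finset.mem_sigma] at h ⊢
    exact ⟨mem_ideals_trans h.2 h.1, sdiff_mem_ideals h.1 J⟩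
  · rintro ⟨J, L⟩ h
    have hd : Disjoint L J :=
      Set.disjoint_left.2 fun x hx => ((mem_ideals.1 (Finset.mem_sigma.1 h).2).1 hx).2
    rw [Set.union_sdiff_left, hd.sdiff_eq_left]
  · rintro ⟨D, J⟩ h
    rw [Set.union_sdiff_cancel (mem_ideals.1 (Finset.mem_sigma.1 h).2).1]
  · rintro ⟨J, L⟩ h
    have hd : Disjoint L J :=
      Set.disjoint_left.2 fun x hx => ((mem_ideals.1 (Finset.mem_sigma.1 h).2).1 hx).2
    rw [Set.union_sdiff_left, hd.sdiff_eq_left, Set.sdiff_sdiff]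

theorem idealSum_eq_one_left (R : WNP) (hf : ∀ a b, a ≠ 1 → f a b = 0) :
    idealSum R f = f 1 R := by
  rw [idealSum, idealSumOn, Finset.sum_eq_single_of_mem Set.univ self_mem_ideals]
  · rw [sub_rep_univ, Set.sdiff_self, sub_eq_one.2 rfl]
  · refine fun J _ hJ => hf _ _ fun h => hJ ?_
    rw [sub_eq_one, Set.sdiff_eq_empty] at h
    exact Set.univ_subset_iff.1 h

theorem idealSum_eq_one_right (R : WNP) (hf : ∀ a b, b ≠ 1 → f a b = 0) :
    idealSum R f = f R 1 := by
  rw [idealSum, idealSumOn, Finset.sum_eq_single_of_mem ∅ empty_mem_ideals]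
  · rw [Set.sdiff_empty, sub_rep_univ, sub_eq_one.2 rfl]
  · exact fun J _ hJ => hf _ _ (mt sub_eq_one.1 hJ)

end IdealSum

open Classical in
theorem cast_numIdeals {A : Type*} [AddCommMonoidWithOne A] (P Q R : WNP) :
    (numIdeals P Q R : A) = idealSum R fun a b => if a = P ∧ b = Q then 1 else 0 := by
  have hsub : ∀ J S, Iso (R.rep.restrict J) S.rep ↔ sub R.rep R.rep_isWN J = S := fun J S => by
    conv_rhs => rw [← mk_rep S]
    exact mk_eq_mk.symm
  rw [idealSum, idealSumOn, Finset.sum_boole, numIdeals, ← Set.ncard_coe_finset]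
  simp only [Finset.coe_filter, mem_ideals_univ, hsub, Set.compl_eq_univ_sdiff]

theorem exists_isIdeal_of_numIdeals_ne_zero {P Q R : WNP} (h : numIdeals P Q R ≠ 0) :
    ∃ (S : DoublePoset) (hS : S.IsWN) (J : Set S.carrier),
      R = mk S hS ∧ S.IsIdeal J ∧ P = sub S hS Jᶜ ∧ Q = sub S hS J := by
  obtain ⟨J, hJ, hP, hQ⟩ := Set.nonempty_of_ncard_ne_zero h
  refine ⟨R.rep, R.rep_isWN, J, (mk_rep R).symm, hJ, ?_, ?_⟩
  · rw [← mk_rep P]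
    exact mk_eq_mk.2 hP.symm
  · rw [← mk_rep Q]
    exact mk_eq_mk.2 hQ.symm

/-- The number of pairs `(x, y)` with `x ≤₁ y`. -/
noncomputable def hrel (R : WNP) : ℕ := R.rep.relCard Set.univ Set.univ

theorem hrel_mk (P : DoublePoset) (hP : P.IsWN) :
    hrel (mk P hP) = P.relCard Set.univ Set.univ := by
  obtain ⟨e, he⟩ := rep_mk P hP
  rw [hrel, ← relCard_image he, Set.image_univ, e.range_eq_univ]

theorem hrel_sub (P : DoublePoset) (hP : P.IsWN) (C : Set P.carrier) :
    hrel (sub P hP C) = P.relCard C C :=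
  (hrel_mk _ _).trans <| (relCard_image (isEmb_val P C) Set.univ Set.univ).symm.trans <|
    congrArg (fun A => P.relCard A A) (val_image_univ P C)

theorem hrel_mk_eq_add {P : DoublePoset} (hP : P.IsWN) (A : Set P.carrier) :
    hrel (mk P hP) = hrel (sub P hP A) + hrel (sub P hP Aᶜ) + P.relCard A Aᶜ + P.relCard Aᶜ A := by
  rw [hrel_mk, hrel_sub, hrel_sub, relCard_univ_left A, relCard_univ_right A A,
    relCard_univ_right Aᶜ A]
  ring

theorem hrel_mul (Q R : WNP) : hrel (Q * R) = hrel Q + hrel R := by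
  obtain ⟨P, hP, A, hA, rfl, rfl⟩ := exists_isCut Q R
  have hAc : P.relCard A Aᶜ = 0 := relCard_eq_zero fun x hx y hy => (hA.not_le₁ hP.1 hx hy).1
  have hcA : P.relCard Aᶜ A = 0 := relCard_eq_zero fun x hx y hy => (hA.not_le₁ hP.1 hy hx).2
  rw [sub_mul_sub_compl hP hA, hrel_mk_eq_add hP A, hAc, hcA, add_zero, add_zero]

theorem hrel_pos {P : WNP} (h : P ≠ 1) : 0 < hrel P := by
  have := P.rep.finite
  have := P.rep.po₁
  obtain ⟨x⟩ : Nonempty P.rep.carrier := not_isEmpty_iff.1 (mt eq_one_of_isEmpty h)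
  rw [hrel, relCard, Set.ncard_pos]
  exact ⟨(x, x), ⟨trivial, trivial⟩, refl_of P.rep.le₁ x⟩

section Stack

variable {P : DoublePoset} (hP : P.IsWN) {A : Set P.carrier}

theorem stack_sub_sub_compl (hA : P.swap.IsCut A) :
    stack (sub P hP A) (sub P hP Aᶜ) = mk P hP := by
  apply swap_injective
  rw [swap_stack, sub, sub, swap_mk, swap_mk, swap_mk]
  exact sub_mul_sub_compl hP.swap hA

theorem exists_isCut_swap (Q R : WNP) : ∃ (P : DoublePoset) (hP : P.IsWN) (A : Set P.carrier),
    P.swap.IsCut A ∧ sub P hP A = Q ∧ sub P hP Aᶜ = R := by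
  obtain ⟨P, hP, A, hA, hQ, hR⟩ := exists_isCut Q.swap R.swap
  refine ⟨P.swap, hP.swap, A, hA, swap_injective (hQ ▸ ?_), swap_injective (hR ▸ ?_)⟩ <;>
  exact swap_mk _ _

theorem isIdeal_compl_of_isCut_swap (hA : P.swap.IsCut A) : P.IsIdeal Aᶜ := by
  have := P.po₁
  exact fun x hx y hxy hy => hx (antisymm_of P.le₁ hxy (hA y hy x hx) ▸ hy)

theorem hrel_stack (Q R : WNP) : hrel (stack Q R) = hrel Q + hrel R + Q.card * R.card := by
  obtain ⟨P, hP, A, hA, rfl, rfl⟩ := exists_isCut_swap Q R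
  have hAc : P.relCard A Aᶜ = A.ncard * Aᶜ.ncard :=
    relCard_eq_mul_iff.2 fun x hx y hy => hA x hx y hy
  have hcA : P.relCard Aᶜ A = 0 :=
    relCard_eq_zero fun x hx y hy hxy => isIdeal_compl_of_isCut_swap hA x hx y hxy hy
  rw [stack_sub_sub_compl hP hA, hrel_mk_eq_add hP A, hAc, hcA, card_sub, card_sub, add_zero]

end Stack

theorem eq_stack_or_hrel_lt {P Q R : WNP} (h : numIdeals P Q R ≠ 0) :
    R = stack P Q ∨ hrel R < hrel (stack P Q) := by
  obtain ⟨S, hS, J, rfl, hJ, rfl, rfl⟩ := exists_isIdeal_of_numIdeals_ne_zero h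
  have hzero : S.relCard J Jᶜ = 0 := relCard_eq_zero fun x hx y hy hxy => hy (hJ x hx y hxy)
  have hle : S.relCard Jᶜ J ≤ Jᶜ.ncard * J.ncard := relCard_le_mul
  rw [hrel_stack, hrel_mk_eq_add hS J, card_sub, card_sub]
  rcases hle.eq_or_lt with heq | hlt
  · left
    have hcut : S.swap.IsCut Jᶜ := fun x hx y hy =>
      relCard_eq_mul_iff.1 heq x hx y (Set.notMem_compl_iff.1 hy)
    have hstack : stack (sub S hS Jᶜ) (sub S hS (Jᶜᶜ : Set S.carrier)) = mk S hS :=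
      stack_sub_sub_compl hS hcut
    rw [← hstack, compl_compl]
  · right
    lia

theorem eq_compl_of_isIdeal {P : DoublePoset} {A J : Set P.carrier} (hA : P.swap.IsCut A)
    (hJ : P.IsIdeal J) (hcard : J.ncard = Aᶜ.ncard) : J = Aᶜ := by
  have := P.finite
  by_cases hJA : J ⊆ Aᶜ
  · exact Set.eq_of_subset_of_ncard_le hJA hcard.ge
  · obtain ⟨x, hx, hxA⟩ := Set.not_subset.1 hJA
    have hAJ : Aᶜ ⊆ J := fun y hy => hJ x hx y (hA x (Set.notMem_compl_iff.1 hxA) y hy)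
    exact (Set.eq_of_subset_of_ncard_le hAJ hcard.le).symm

theorem numIdeals_stack (P Q : WNP) : numIdeals P Q (stack P Q) = 1 := by
  classical
  obtain ⟨S, hS, A, hA, rfl, rfl⟩ := exists_isCut_swap P Q
  rw [← Nat.cast_id (numIdeals _ _ _), cast_numIdeals, stack_sub_sub_compl hS hA, idealSum_mk,
    idealSumOn, Finset.sum_eq_single_of_mem Aᶜ
      (mem_ideals_univ.2 (isIdeal_compl_of_isCut_swap hA))]
  · rw [if_pos ⟨by rw [← Set.compl_eq_univ_sdiff, compl_compl], rfl⟩]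
  · refine fun J hJ hJA => if_neg fun h => hJA (eq_compl_of_isIdeal hA (mem_ideals_univ.1 hJ) ?_)
    simpa only [card_sub] using congrArg card h.2

end WNP

/-! ### The product and coproduct of `H_WNP` -/

namespace WNP

theorem idealSum_add {N : Type*} [AddCommMonoid N] (R : WNP) (f g : WNP → WNP → N) :
    (idealSum R fun a b => f a b + g a b) = idealSum R f + idealSum R g :=
  Finset.sum_add_distrib

theorem idealSum_mul_left {A : Type*} [NonUnitalNonAssocSemiring A] (R : WNP) (r : A)
    (f : WNP → WNP → A) : (idealSum R fun a b => r * f a b) = r * idealSum R f :=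
  (Finset.mul_sum _ _ _).symm

theorem idealSum_mul_right {A : Type*} [NonUnitalNonAssocSemiring A] (R : WNP) (r : A)
    (f : WNP → WNP → A) : (idealSum R fun a b => f a b * r) = idealSum R f * r :=
  (Finset.sum_mul _ _ _).symm

end WNP

open WNP

variable {K : Type*} [Field K]

section Product

theorem HWNP.hom_ext {M : Type*} [AddCommGroup M] [Module K M] {f g : HWNP K →ₗ[K] M}
    (h : ∀ P : WNP, f (MonoidAlgebra.single P 1) = g (MonoidAlgebra.single P 1)) : f = g :=
  (MonoidAlgebra.basis WNP K).ext fun P => by simpa only [MonoidAlgebra.basis_apply] using h P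

theorem HWNP.ext {x y : HWNP K} (h : ∀ R, x.coeff R = y.coeff R) : x = y :=
  MonoidAlgebra.coeff_injective (Finsupp.ext h)

theorem coeff_single_one (P R : WNP) [Decidable (R = P)] :
    (MonoidAlgebra.single P 1 : HWNP K).coeff R = if R = P then 1 else 0 := by
  classical
  rw [MonoidAlgebra.coeff_single, Finsupp.single_apply]
  simp only [eq_comm]

theorem coeff_one (R : WNP) [Decidable (R = 1)] :
    (1 : HWNP K).coeff R = if R = 1 then 1 else 0 :=
  coeff_single_one 1 R

theorem starProd_single (P Q : WNP) :
    starProd K (MonoidAlgebra.single P 1) (MonoidAlgebra.single Q 1) =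
      ∑ R ∈ (finite_numIdeals P Q).toFinset, (numIdeals P Q R : K) • MonoidAlgebra.single R 1 := by
  rw [starProd, ← MonoidAlgebra.basis_apply, Module.Basis.constr_basis,
    ← MonoidAlgebra.basis_apply, Module.Basis.constr_basis]

theorem coeff_starProd_single (P Q R : WNP) :
    (starProd K (MonoidAlgebra.single P 1) (MonoidAlgebra.single Q 1)).coeff R =
      numIdeals P Q R := by
  classical
  rw [starProd_single, MonoidAlgebra.coeff_sum, Finsupp.finsetSum_apply]
  simp only [MonoidAlgebra.coeff_smul, Finsupp.smul_apply, coeff_single_one, smul_eq_mul, mul_ite,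
    mul_one, mul_zero, Finset.sum_ite_eq, Set.Finite.mem_toFinset, Set.mem_ofPred_eq]
  exact ite_eq_left_iff.2 fun h => by rw [not_not.1 h, Nat.cast_zero]

theorem coeff_starProd (x y : HWNP K) (R : WNP) :
    (starProd K x y).coeff R = idealSum R fun a b => x.coeff a * y.coeff b := by
  classical
  have h : (starProd K).compr₂ ((MonoidAlgebra.basis WNP K).coord R) =
      idealSum R fun a b => (LinearMap.mul K K).compl₁₂
        ((MonoidAlgebra.basis WNP K).coord a) ((MonoidAlgebra.basis WNP K).coord b) := by
    refine HWNP.hom_ext fun P => HWNP.hom_ext fun Q => (coeff_starProd_single P Q R).trans ?_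
    simp only [cast_numIdeals, idealSum, idealSumOn, LinearMap.sum_apply]
    refine Finset.sum_congr rfl fun J _ => ?_
    change _ = (MonoidAlgebra.single P 1 : HWNP K).coeff _ *
      (MonoidAlgebra.single Q 1 : HWNP K).coeff _
    rw [coeff_single_one, coeff_single_one, ite_zero_mul_ite_zero, one_mul]
  refine (LinearMap.congr_fun₂ h x y).trans ?_
  simp only [idealSum, idealSumOn, LinearMap.sum_apply]
  rfl

theorem starProd_assoc (x y z : HWNP K) :
    starProd K (starProd K x y) z = starProd K x (starProd K y z) := by
  refine HWNP.ext fun R => ?_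
  simp only [coeff_starProd, ← idealSum_mul_left, ← idealSum_mul_right]
  rw [idealSum_coassoc R fun a b c => x.coeff a * y.coeff b * z.coeff c]
  simp only [mul_assoc]

theorem one_starProd (x : HWNP K) : starProd K 1 x = x := by
  classical
  refine HWNP.ext fun R => ?_
  rw [coeff_starProd, idealSum_eq_one_left _ _ fun a b h => by rw [coeff_one, if_neg h, zero_mul],
    coeff_one, if_pos rfl, one_mul]

theorem starProd_one (x : HWNP K) : starProd K x 1 = x := by
  classical
  refine HWNP.ext fun R => ?_
  rw [coeff_starProd, idealSum_eq_one_right _ _ fun a b h => by rw [coeff_one, if_neg h, mul_zero],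
    coeff_one, if_pos rfl, mul_one]

end Product

section Coproduct

/-- The coefficient of `Q ⊗ R` in an element of `H_WNP ⊗ H_WNP`. -/
noncomputable def coeff₂ (Q R : WNP) : HWNP K ⊗[K] HWNP K →ₗ[K] K :=
  ((MonoidAlgebra.basis WNP K).tensorProduct (MonoidAlgebra.basis WNP K)).coord (Q, R)

theorem coeff₂_tmul (Q R : WNP) (x y : HWNP K) :
    coeff₂ Q R (x ⊗ₜ y) = x.coeff Q * y.coeff R := by
  rw [coeff₂, Module.Basis.coord_apply, Module.Basis.tensorProduct_repr_tmul_apply, smul_eq_mul,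
    mul_comm]
  rfl

theorem tensor_ext {s t : HWNP K ⊗[K] HWNP K} (h : ∀ Q R, coeff₂ Q R s = coeff₂ Q R t) : s = t :=
  ((MonoidAlgebra.basis WNP K).tensorProduct (MonoidAlgebra.basis WNP K)).ext_elem
    fun p => h p.1 p.2

theorem comulWNP_single (P : WNP) :
    comulWNP K (MonoidAlgebra.single P 1) = ∑ p ∈ (finite_factorizations P).toFinset,
      MonoidAlgebra.single p.1 1 ⊗ₜ[K] MonoidAlgebra.single p.2 1 := by
  rw [comulWNP, ← MonoidAlgebra.basis_apply, Module.Basis.constr_basis]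

theorem coeff₂_comulWNP (Q R : WNP) (x : HWNP K) :
    coeff₂ Q R (comulWNP K x) = x.coeff (Q * R) := by
  classical
  have h : coeff₂ Q R ∘ₗ comulWNP K = (MonoidAlgebra.basis WNP K).coord (Q * R) := by
    refine HWNP.hom_ext fun P => ?_
    change coeff₂ Q R (comulWNP K _) = (MonoidAlgebra.single P 1 : HWNP K).coeff (Q * R)
    have hp : ∀ p : WNP × WNP, (Q = p.1 ∧ R = p.2) ↔ (Q, R) = p :=
      fun p => Prod.mk_inj.symm
    simp only [comulWNP_single, map_sum, coeff₂_tmul, coeff_single_one, ite_zero_mul_ite_zero,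
      mul_one, hp, Finset.sum_ite_eq, Set.Finite.mem_toFinset, Set.mem_ofPred_eq]
  exact LinearMap.congr_fun h x

theorem coeff_mul_of_mem_prim {x : HWNP K} (hx : x ∈ Prim K) (Q R : WNP) :
    x.coeff (Q * R) = x.coeff Q * (1 : HWNP K).coeff R + (1 : HWNP K).coeff Q * x.coeff R := by
  rw [← coeff₂_comulWNP, mem_prim.1 hx, map_add, coeff₂_tmul, coeff₂_tmul]

theorem hConnected_of_mem_prim {x : HWNP K} (hx : x ∈ Prim K) {P : WNP} (hP : x.coeff P ≠ 0) :
    P.HConnected := by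
  classical
  by_contra hcon
  have h1 : P ≠ 1 := by
    rintro rfl
    have := coeff_mul_of_mem_prim hx 1 1
    rw [coeff_one, if_pos rfl, mul_one, mul_one, one_mul] at this
    exact hP (left_eq_add.1 this)
  obtain ⟨Q, R, hQ, hR, rfl⟩ := exists_mul_of_not_hConnected h1 hcon
  apply hP
  rw [coeff_mul_of_mem_prim hx, coeff_one, coeff_one, if_neg hQ, if_neg hR, mul_zero, zero_mul,
    add_zero]

theorem prim_eq_span : Prim K =
    Submodule.span K {x | ∃ P : WNP, P.HConnected ∧ x = MonoidAlgebra.single P 1} := by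
  apply le_antisymm
  · intro x hx
    rw [← MonoidAlgebra.sum_coeff_single x]
    refine Submodule.sum_mem _ fun P hP => ?_
    have hcon : P.HConnected := hConnected_of_mem_prim hx (Finsupp.mem_support_iff.1 hP)
    rw [← mul_one (x.coeff P), ← MonoidAlgebra.smul_single']
    exact Submodule.smul_mem _ _ (Submodule.subset_span ⟨P, hcon, rfl⟩)
  · rw [Submodule.span_le]
    rintro _ ⟨P, hP, rfl⟩
    exact single_mem_prim K hP

theorem coeff₂_map_starProd (Q R : WNP) (s t : HWNP K ⊗[K] HWNP K) :
    coeff₂ Q R (TensorProduct.map (TensorProduct.lift (starProd K))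
        (TensorProduct.lift (starProd K))
        (TensorProduct.tensorTensorTensorComm K _ _ _ _ (s ⊗ₜ t))) =
      idealSum Q fun a b => idealSum R fun c d => coeff₂ a c s * coeff₂ b d t := by
  induction s with
  | zero => simp [idealSum, idealSumOn]
  | add s s' h h' => simp only [TensorProduct.add_tmul, map_add, h, h', add_mul, idealSum_add]
  | tmul x x' =>
    induction t with
    | zero => simp [idealSum, idealSumOn]
    | add s s' h h' => simp only [TensorProduct.tmul_add, map_add, h, h', mul_add, idealSum_add]
    | tmul y y' =>
      simp only [TensorProduct.tensorTensorTensorComm_tmul, TensorProduct.map_tmul,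
        TensorProduct.lift.tmul, coeff₂_tmul, coeff_starProd, ← idealSum_mul_right]
      simp only [← idealSum_mul_left, mul_mul_mul_comm]

theorem comulWNP_starProd (x y : HWNP K) :
    comulWNP K (starProd K x y) =
      TensorProduct.map (TensorProduct.lift (starProd K)) (TensorProduct.lift (starProd K))
        (TensorProduct.tensorTensorTensorComm K _ _ _ _ (comulWNP K x ⊗ₜ comulWNP K y)) := by
  refine tensor_ext fun Q R => ?_
  simp only [coeff₂_map_starProd, coeff₂_comulWNP, coeff_starProd, idealSum_mul]

end Coproduct

/-! ### The tensor coalgebra -/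

section TensorCoalgebra

open TensorAlgebra (ι ιInv algebraMapInv)

variable {V W : Type*} [AddCommGroup V] [Module K V] [AddCommGroup W] [Module K W]

variable (K) in
/-- The word `v₁ ⋯ vₙ` of `T(V)` with letters in a list. -/
noncomputable def word (l : List V) : TensorAlgebra K V := (l.map (ι K)).prod

@[simp] theorem word_nil : word K ([] : List V) = 1 := rfl

@[simp] theorem word_cons (v : V) (l : List V) : word K (v :: l) = ι K v * word K l := by
  simp [word]

theorem word_append (l m : List V) : word K (l ++ m) = word K l * word K m := by
  simp [word]

theorem word_ofFn (n : ℕ) (x : Fin n → V) :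
    word K (List.ofFn x) = TensorAlgebra.tprod K V n x := by
  rw [word, List.map_ofFn, TensorAlgebra.tprod_apply]
  rfl

theorem deconc_word_eq_sum (l : List V) :
    deconc K V (word K l) =
      ∑ i ∈ Finset.range (l.length + 1), word K (l.take i) ⊗ₜ word K (l.drop i) :=
  deconc_word l

theorem tensorAlgebra_hom_ext {M : Type*} [AddCommGroup M] [Module K M]
    {f g : TensorAlgebra K V →ₗ[K] M} (h : ∀ l, f (word K l) = g (word K l)) : f = g := by
  suffices H : ∀ (w : TensorAlgebra K V) (l : List V), f (word K l * w) = g (word K l * w) by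
    ext w
    simpa using H w []
  intro w
  induction w using tensorAlgebra_left_induction with
  | one => intro l; simpa using h l
  | cons v w ih => intro l; simpa [word_append, mul_assoc] using ih (l ++ [v])
  | add a b ha hb => intro l; simp only [mul_add, map_add, ha, hb]
  | smul r a ha => intro l; simp only [mul_smul_comm, map_smul, ha]

theorem counit_eq (w : TensorAlgebra K V) : Coalgebra.counit (R := K) w = algebraMapInv w := rfl

theorem comul_eq (w : TensorAlgebra K V) : Coalgebra.comul (R := K) w = deconc K V w := rfl

@[simp] theorem algebraMapInv_ι (v : V) : algebraMapInv (ι K v) = (0 : K) := by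
  simp [algebraMapInv]

theorem ιInv_mul (a b : TensorAlgebra K V) :
    ιInv (a * b) = algebraMapInv a • ιInv b + algebraMapInv b • ιInv a := by
  let _ : Module Kᵐᵒᵖ V := Module.compHom _ ((RingHom.id K).fromOpposite mul_comm)
  have : IsCentralScalar K V := ⟨fun r m => rfl⟩
  have fst_eq (a : TensorAlgebra K V) :
      (TensorAlgebra.toTrivSqZeroExt a).fst = algebraMapInv a := by
    have : (TrivSqZeroExt.fstHom K K V).comp TensorAlgebra.toTrivSqZeroExt =
        (algebraMapInv : TensorAlgebra K V →ₐ[K] K) := by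
      ext v
      simp
    exact DFunLike.congr_fun this a
  change (TensorAlgebra.toTrivSqZeroExt (a * b)).snd = _ • (TensorAlgebra.toTrivSqZeroExt b).snd +
    _ • (TensorAlgebra.toTrivSqZeroExt a).snd
  rw [map_mul, TrivSqZeroExt.snd_mul, fst_eq, fst_eq]
  rfl

@[simp] theorem ιInv_one : ιInv (1 : TensorAlgebra K V) = 0 := by
  simpa using ιInv_mul (1 : TensorAlgebra K V) 1

@[simp] theorem ιInv_ι (v : V) : ιInv (ι K v) = v := TensorAlgebra.ι_leftInverse v

theorem ιInv_ι_mul (v : V) (w : TensorAlgebra K V) : ιInv (ι K v * w) = algebraMapInv w • v := by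
  rw [ιInv_mul]
  simp

variable (K V) in
/-- The map `a ⊗ b ↦ π(a) b` on `T(V) ⊗ T(V)`, where `π` is the projection on `V`. Composed with
the deconcatenation, it is the projection of `T(V)` on the span of the nonempty words. -/
noncomputable def headMul : TensorAlgebra K V ⊗[K] TensorAlgebra K V →ₗ[K] TensorAlgebra K V :=
  LinearMap.mul' K _ ∘ₗ (ι K ∘ₗ ιInv).rTensor _

@[simp] theorem headMul_tmul (a b : TensorAlgebra K V) :
    headMul K V (a ⊗ₜ b) = ι K (ιInv a) * b := rfl

theorem headMul_ι_tmul_one_mul (v : V) (s : TensorAlgebra K V ⊗[K] TensorAlgebra K V) :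
    headMul K V ((ι K v ⊗ₜ 1) * s) =
      ι K v * TensorProduct.lid K _ (Coalgebra.counit.rTensor _ s) := by
  induction s with
  | zero => simp
  | add x y hx hy => simp only [mul_add, map_add, hx, hy]
  | tmul x y => simp [ιInv_ι_mul, counit_eq]

theorem headMul_deconc_ι_mul (v : V) (w : TensorAlgebra K V) :
    headMul K V (deconc K V (ι K v * w)) = ι K v * w := by
  rw [deconc_ι_mul, map_add, headMul_ι_tmul_one_mul, ← comul_eq, Coalgebra.rTensor_counit_comul]
  simp

theorem eq_counit_add_headMul (t : TensorAlgebra K V) :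
    t = algebraMapInv t • 1 + headMul K V (deconc K V t) := by
  induction t using tensorAlgebra_left_induction with
  | one => simp [deconc_one]
  | cons v w _ => simp [headMul_deconc_ι_mul]
  | add a b ha hb =>
    conv_lhs => rw [ha, hb]
    simp only [map_add, add_smul]
    abel
  | smul r a ha =>
    conv_lhs => rw [ha]
    simp only [map_smul, smul_add, smul_assoc]

theorem deconc_ι (v : V) : deconc K V (ι K v) = ι K v ⊗ₜ 1 + 1 ⊗ₜ ι K v := by
  simpa [deconc_one] using deconc_ι_mul (K := K) v 1

theorem ι_ιInv_of_primitive {t : TensorAlgebra K V} (h : deconc K V t = t ⊗ₜ 1 + 1 ⊗ₜ t) :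
    ι K (ιInv t) = t := by
  have counit_smul : algebraMapInv t • (1 : TensorAlgebra K V) = 0 := by
    have := congrArg (TensorProduct.lid K _) (Coalgebra.rTensor_counit_comul (R := K) t)
    rw [comul_eq, h] at this
    simpa [counit_eq] using this
  have := eq_counit_add_headMul t
  rw [counit_smul, h] at this
  simpa using this.symm

theorem deconc_mul (a b : TensorAlgebra K V) :
    deconc K V (a * b) = (a ⊗ₜ 1) * deconc K V b + deconc K V a * (1 ⊗ₜ b) - a ⊗ₜ b := by
  induction a using tensorAlgebra_left_induction with
  | one => simp [deconc_one, ← Algebra.TensorProduct.one_def]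
  | add a a' ha hb => simp only [add_mul, map_add, ha, hb, TensorProduct.add_tmul]; abel
  | smul r a ha =>
    simp only [smul_mul_assoc, map_smul, ha, ← TensorProduct.smul_tmul', smul_add, smul_sub]
  | cons v w ih =>
    rw [mul_assoc, deconc_ι_mul, ih, deconc_ι_mul, add_mul, mul_sub, mul_add]
    simp only [← mul_assoc, Algebra.TensorProduct.tmul_mul_tmul, one_mul, mul_one]
    abel

/-- The morphism `T(φ) : T(V) → T(W)` of algebras that applies `φ` to each letter. -/
noncomputable def mapT (φ : V →ₗ[K] W) : TensorAlgebra K V →ₐ[K] TensorAlgebra K W :=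
  TensorAlgebra.lift K (ι K ∘ₗ φ)

@[simp] theorem mapT_ι (φ : V →ₗ[K] W) (v : V) : mapT φ (ι K v) = ι K (φ v) := by simp [mapT]

theorem mapT_word (φ : V →ₗ[K] W) (l : List V) : mapT φ (word K l) = word K (l.map φ) := by
  induction l with
  | nil => simp
  | cons v l ih => simp only [List.map_cons, word_cons, map_mul, ih, mapT_ι]

theorem mapT_tprod (φ : V →ₗ[K] W) (n : ℕ) (x : Fin n → V) :
    mapT φ (TensorAlgebra.tprod K V n x) = TensorAlgebra.tprod K W n fun i => φ (x i) := by
  rw [← word_ofFn, mapT_word, List.map_ofFn, word_ofFn]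
  rfl

/-- `T(φ)` as a morphism of coalgebras. -/
noncomputable def mapTc (φ : V →ₗ[K] W) : TensorAlgebra K V →ₗc[K] TensorAlgebra K W where
  toLinearMap := (mapT φ).toLinearMap
  counit_comp := by
    have : (algebraMapInv.comp (mapT φ) : TensorAlgebra K V →ₐ[K] K) = algebraMapInv := by
      ext v
      simp
    exact congrArg AlgHom.toLinearMap this
  map_comp_comul := by
    refine tensorAlgebra_hom_ext fun l => ?_
    simp only [LinearMap.comp_apply, AlgHom.toLinearMap_apply, comul_eq, mapT_word,
      deconc_word_eq_sum, map_sum, TensorProduct.map_tmul, List.length_map, List.map_take,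
      List.map_drop]

@[simp] theorem mapTc_apply (φ : V →ₗ[K] W) (w : TensorAlgebra K V) : mapTc φ w = mapT φ w := rfl

theorem algebraMapInv_mapT (φ : V →ₗ[K] W) (w : TensorAlgebra K V) :
    algebraMapInv (mapT φ w) = algebraMapInv w :=
  CoalgHomClass.counit_comp_apply (mapTc φ) w

theorem ιInv_mapT (φ : V →ₗ[K] W) (w : TensorAlgebra K V) :
    ιInv (mapT φ w) = φ (ιInv w) := by
  induction w using tensorAlgebra_left_induction with
  | one => simp
  | add a b ha hb => simp only [map_add, ha, hb]
  | smul r a ha => simp only [map_smul, ha]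
  | cons v w _ => rw [map_mul, mapT_ι, ιInv_ι_mul, ιInv_ι_mul, algebraMapInv_mapT, map_smul]

theorem coalgHom_apply {C : Type*} [AddCommGroup C] [Module K C] [Coalgebra K C]
    (F : C →ₗc[K] TensorAlgebra K V) (c : C) :
    F c = Coalgebra.counit (R := K) c • 1 + headMul K V
      (TensorProduct.map F.toLinearMap F.toLinearMap (Coalgebra.comul (R := K) c)) := by
  conv_lhs => rw [eq_counit_add_headMul (F c)]
  rw [← counit_eq, CoalgHomClass.counit_comp_apply, ← comul_eq]
  exact congrArg (fun t => _ + headMul K V t) (CoalgHomClass.map_comp_comul_apply F c).symm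

theorem coalgHom_word_tmul_word
    (F : TensorAlgebra K V ⊗[K] TensorAlgebra K V →ₗc[K] TensorAlgebra K W) (l m : List V) :
    F (word K l ⊗ₜ word K m) =
      Coalgebra.counit (R := K) (word K l ⊗ₜ[K] word K m) • 1 +
      ∑ i ∈ Finset.range (l.length + 1), ∑ j ∈ Finset.range (m.length + 1),
        ι K (ιInv (F (word K (l.take i) ⊗ₜ word K (m.take j)))) *
          F (word K (l.drop i) ⊗ₜ word K (m.drop j)) := by
  rw [coalgHom_apply, TensorProduct.comul_tmul, comul_eq, comul_eq, deconc_word_eq_sum,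
    deconc_word_eq_sum, Finset.sum_comm]
  simp [TensorProduct.sum_tmul, TensorProduct.tmul_sum, map_sum,
    TensorProduct.AlgebraTensorModule.tensorTensorTensorComm_tmul]

theorem coalgHom_word_ext
    {F G : TensorAlgebra K V ⊗[K] TensorAlgebra K V →ₗc[K] TensorAlgebra K W}
    (h_one : G (1 ⊗ₜ 1) = 1)
    (h : ∀ l m : List V, ιInv (F (word K l ⊗ₜ word K m)) = ιInv (G (word K l ⊗ₜ word K m)))
    (l m : List V) : F (word K l ⊗ₜ word K m) = G (word K l ⊗ₜ word K m) := by
  induction hn : l.length + m.length using Nat.strong_induction_on generalizing l m with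
  | _ n ih =>
    rw [coalgHom_word_tmul_word F, coalgHom_word_tmul_word G]
    congr 1
    refine Finset.sum_congr rfl fun i hi => Finset.sum_congr rfl fun j hj => ?_
    rw [Finset.mem_range] at hi hj
    rw [h]
    by_cases hij : i = 0 ∧ j = 0
    · obtain ⟨rfl, rfl⟩ := hij
      simp [h_one]
    · rw [ih ((l.drop i).length + (m.drop j).length) (by simp only [List.length_drop]; omega) _ _
        rfl]

theorem coalgHom_ext {F G : TensorAlgebra K V ⊗[K] TensorAlgebra K V →ₗc[K] TensorAlgebra K W}
    (h_one : G (1 ⊗ₜ 1) = 1)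
    (h : ∀ l m : List V, ιInv (F (word K l ⊗ₜ word K m)) = ιInv (G (word K l ⊗ₜ word K m))) :
    F.toLinearMap = G.toLinearMap :=
  TensorProduct.ext <| tensorAlgebra_hom_ext fun l => tensorAlgebra_hom_ext fun m =>
    coalgHom_word_ext h_one h l m

/-- The brackets `br` are the projections on `V` of the products of words by `star`; this is the
second condition in `IsBInfty`. -/
def HasBrackets (star : TensorAlgebra K V ⊗[K] TensorAlgebra K V →ₗc[K] TensorAlgebra K V)
    (br : Brackets K V) : Prop :=
  ∀ (m n : ℕ+) (x : Fin m → V) (y : Fin n → V),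
    ιInv (star (TensorAlgebra.tprod K V m x ⊗ₜ TensorAlgebra.tprod K V n y)) =
      br m n (PiTensorProduct.tprod K x ⊗ₜ PiTensorProduct.tprod K y)

theorem IsBInftyHom.ιInv_star_word {brV : Brackets K V} {brW : Brackets K W} {φ : V →ₗ[K] W}
    (hφ : IsBInftyHom brV brW φ)
    {starV : TensorAlgebra K V ⊗[K] TensorAlgebra K V →ₗc[K] TensorAlgebra K V}
    (hV : HasBrackets starV brV)
    {starW : TensorAlgebra K W ⊗[K] TensorAlgebra K W →ₗc[K] TensorAlgebra K W}
    (hW : HasBrackets starW brW) {l m : List V} (hl : l ≠ []) (hm : m ≠ []) :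
    φ (ιInv (starV (word K l ⊗ₜ word K m))) =
      ιInv (starW (mapT φ (word K l) ⊗ₜ mapT φ (word K m))) := by
  have word_eq_tprod (l : List V) : word K l = TensorAlgebra.tprod K V l.length l.get := by
    rw [← word_ofFn, List.ofFn_get]
  let m' : ℕ+ := ⟨l.length, List.length_pos_of_ne_nil hl⟩
  let n' : ℕ+ := ⟨m.length, List.length_pos_of_ne_nil hm⟩
  rw [word_eq_tprod, word_eq_tprod, mapT_tprod, mapT_tprod]
  exact (congrArg φ (hV m' n' _ _)).trans ((hφ m' n' _ _).trans (hW m' n' _ _).symm)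

theorem IsBInftyHom.mapT_star {brV : Brackets K V} {brW : Brackets K W} {φ : V →ₗ[K] W}
    (hφ : IsBInftyHom brV brW φ)
    {starV : TensorAlgebra K V ⊗[K] TensorAlgebra K V →ₗc[K] TensorAlgebra K V}
    (hopfV : IsHopfProduct starV) (hV : HasBrackets starV brV)
    {starW : TensorAlgebra K W ⊗[K] TensorAlgebra K W →ₗc[K] TensorAlgebra K W}
    (hopfW : IsHopfProduct starW) (hW : HasBrackets starW brW) (a b : TensorAlgebra K V) :
    mapT φ (starV (a ⊗ₜ b)) = starW (mapT φ a ⊗ₜ mapT φ b) := by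
  refine LinearMap.congr_fun (coalgHom_ext (F := (mapTc φ).comp starV)
    (G := starW.comp (Coalgebra.TensorProduct.map (mapTc φ) (mapTc φ))) ?_ fun l m => ?_) (a ⊗ₜ b)
  · simp [hopfW.one_star]
  · simp only [CoalgHom.comp_apply, Coalgebra.TensorProduct.map_tmul, mapTc_apply, ιInv_mapT]
    rcases eq_or_ne l [] with rfl | hl
    · simp [hopfV.one_star, hopfW.one_star, ιInv_mapT]
    rcases eq_or_ne m [] with rfl | hm
    · simp [hopfV.star_one, hopfW.star_one, ιInv_mapT]
    exact hφ.ιInv_star_word hV hW hl hm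

theorem isBInftyHom_of_mapT_star {brV : Brackets K V} {brW : Brackets K W} {φ : V →ₗ[K] W}
    {starV : TensorAlgebra K V ⊗[K] TensorAlgebra K V →ₗc[K] TensorAlgebra K V}
    (hV : HasBrackets starV brV)
    {starW : TensorAlgebra K W ⊗[K] TensorAlgebra K W →ₗc[K] TensorAlgebra K W}
    (hW : HasBrackets starW brW)
    (hφ : ∀ a b, mapT φ (starV (a ⊗ₜ b)) = starW (mapT φ a ⊗ₜ mapT φ b)) :
    IsBInftyHom brV brW φ := fun m n x y => by
  rw [← hV, ← hW, ← mapT_tprod, ← mapT_tprod, ← hφ, ιInv_mapT]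

section Antipode

variable {A : Type*} [Ring A] [Algebra K A]

open WithConv

theorem convMul_word (f g : WithConv (TensorAlgebra K V →ₗ[K] A)) (l : List V) :
    (f * g) (word K l) =
      ∑ i ∈ Finset.range (l.length + 1), f (word K (l.take i)) * g (word K (l.drop i)) := by
  rw [LinearMap.convMul_apply, comul_eq, deconc_word_eq_sum]
  simp only [map_sum, TensorProduct.map_tmul, LinearMap.mul'_apply]

theorem conv_pow_word_eq_zero {f : WithConv (TensorAlgebra K V →ₗ[K] A)} (hf : f 1 = 0) {k : ℕ}
    {l : List V} (h : l.length < k) : (f ^ k) (word K l) = 0 := by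
  induction k generalizing l with
  | zero => omega
  | succ k ih =>
    rw [pow_succ', convMul_word]
    refine Finset.sum_eq_zero fun i hi => ?_
    rcases Nat.eq_zero_or_pos i with rfl | hi0
    · rw [List.take_zero, word_nil, hf, zero_mul]
    · rw [Finset.mem_range] at hi
      rw [ih (by rw [List.length_drop]; omega), mul_zero]

theorem word_mem_pow_range_ι (l : List V) :
    word K l ∈ LinearMap.range (ι K : V →ₗ[K] TensorAlgebra K V) ^ l.length := by
  induction l with
  | nil => simp
  | cons v l ih =>
    rw [word_cons, List.length_cons, pow_succ']
    exact Submodule.mul_mem_mul ⟨v, rfl⟩ ih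

theorem exists_forall_word_eq (f : ℕ → TensorAlgebra K V →ₗ[K] A) :
    ∃ g : TensorAlgebra K V →ₗ[K] A, ∀ l, g (word K l) = f l.length (word K l) := by
  classical
  refine ⟨DirectSum.toModule K ℕ A (fun n => f n ∘ₗ Submodule.subtype _) ∘ₗ
    (DirectSum.decomposeLinearEquiv
      (LinearMap.range (ι K : V →ₗ[K] TensorAlgebra K V) ^ ·)).toLinearMap, fun l => ?_⟩
  change DirectSum.toModule K ℕ A _ (DirectSum.decompose _ (word K l)) = _
  rw [DirectSum.decompose_of_mem _ (word_mem_pow_range_ι l)]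
  exact DirectSum.toModule_lof K l.length _

theorem sum_conv_pow_word {f : WithConv (TensorAlgebra K V →ₗ[K] A)} (hf : f 1 = 0) {n : ℕ}
    {l : List V} (h : l.length < n) :
    (∑ k ∈ Finset.range n, f ^ k) (word K l) =
      (∑ k ∈ Finset.range (l.length + 1), f ^ k) (word K l) := by
  induction n, h using Nat.le_induction with
  | base => rfl
  | succ n hn ih =>
    rw [Finset.sum_range_succ, ← ih]
    exact add_eq_left.2 (conv_pow_word_eq_zero hf hn)

/-- The inverse is the geometric series in `1 - f`, of which only finitely many terms act on a
given word. -/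
theorem exists_conv_mul_eq_one {f : WithConv (TensorAlgebra K V →ₗ[K] A)} (hf : f 1 = 1) :
    ∃ g : WithConv (TensorAlgebra K V →ₗ[K] A), g * f = 1 := by
  have one_sub_one : (1 - f) 1 = 0 := by
    change (1 : WithConv (TensorAlgebra K V →ₗ[K] A)) 1 - f 1 = 0
    rw [LinearMap.convOne_apply, hf, counit_eq, map_one, map_one, sub_self]
  obtain ⟨g, hg⟩ := exists_forall_word_eq fun n =>
    (∑ k ∈ Finset.range (n + 1), (1 - f) ^ k).ofConv
  refine ⟨toConv g, ofConv_injective (tensorAlgebra_hom_ext fun l => ?_)⟩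
  calc (toConv g * f) (word K l)
    _ = ((∑ k ∈ Finset.range (l.length + 1), (1 - f) ^ k) * f) (word K l) := by
        rw [convMul_word, convMul_word]
        refine Finset.sum_congr rfl fun i _ => congrArg (· * _) ?_
        rw [sum_conv_pow_word one_sub_one (by rw [List.length_take]; omega)]
        exact hg _
    _ = (1 - (1 - f) ^ (l.length + 1)) (word K l) := by
        rw [← geom_sum_mul_neg, sub_sub_cancel]
    _ = (1 : WithConv (TensorAlgebra K V →ₗ[K] A)) (word K l) :=
        sub_eq_self.2 (conv_pow_word_eq_zero one_sub_one (Nat.lt_succ_self _))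

theorem isUnit_conv_of_map_one {f : WithConv (TensorAlgebra K V →ₗ[K] A)} (hf : f 1 = 1) :
    IsUnit f := by
  obtain ⟨g, hgf⟩ := exists_conv_mul_eq_one hf
  have hg : g 1 = 1 := by
    have : (g * f) (word K []) = (1 : WithConv (TensorAlgebra K V →ₗ[K] A)) (word K []) := by
      rw [hgf]
    rw [convMul_word, LinearMap.convOne_apply] at this
    simpa [hf, counit_eq] using this
  obtain ⟨h, hhg⟩ := exists_conv_mul_eq_one hg
  rw [left_inv_eq_right_inv hhg hgf] at hhg
  exact ⟨⟨f, g, hhg, hgf⟩, rfl⟩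

/-- The space `T(V)` as an algebra for a product `star` other than the concatenation. -/
def StarAlgebra (_star : TensorAlgebra K V ⊗[K] TensorAlgebra K V →ₗ[K] TensorAlgebra K V) :
    Type _ := TensorAlgebra K V

namespace StarAlgebra

variable {star : TensorAlgebra K V ⊗[K] TensorAlgebra K V →ₗ[K] TensorAlgebra K V}

noncomputable instance : AddCommGroup (StarAlgebra star) :=
  inferInstanceAs (AddCommGroup (TensorAlgebra K V))

noncomputable instance : Module K (StarAlgebra star) :=
  inferInstanceAs (Module K (TensorAlgebra K V))

noncomputable instance : Mul (StarAlgebra star) where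
  mul x y := star ((x : TensorAlgebra K V) ⊗ₜ (y : TensorAlgebra K V))

/-- The ring structure of `StarAlgebra star` when `star` is unital and associative. -/
noncomputable abbrev ring (one_star : ∀ x, star (1 ⊗ₜ x) = x)
    (star_one : ∀ x, star (x ⊗ₜ 1) = x)
    (star_assoc : ∀ x y z, star (star (x ⊗ₜ y) ⊗ₜ z) = star (x ⊗ₜ star (y ⊗ₜ z))) :
    Ring (StarAlgebra star) :=
  { (inferInstance : AddCommGroup (StarAlgebra star)),
    (inferInstance : Mul (StarAlgebra star)) with
    one := (1 : TensorAlgebra K V)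
    mul_assoc := star_assoc
    one_mul := one_star
    mul_one := star_one
    left_distrib := fun x y z =>
      (congrArg star (TensorProduct.tmul_add x y z)).trans (map_add _ _ _)
    right_distrib := fun x y z =>
      (congrArg star (TensorProduct.add_tmul x y z)).trans (map_add _ _ _)
    zero_mul := fun x => (congrArg star (TensorProduct.zero_tmul _ x)).trans (map_zero _)
    mul_zero := fun x => (congrArg star (TensorProduct.tmul_zero _ x)).trans (map_zero _) }

theorem smul_mul (r : K) (x y : StarAlgebra star) : r • x * y = r • (x * y) := by
  have h (a b : TensorAlgebra K V) : star ((r • a) ⊗ₜ b) = r • star (a ⊗ₜ b) := by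
    rw [← TensorProduct.smul_tmul', map_smul]
  exact h x y

theorem mul_smul (r : K) (x y : StarAlgebra star) : x * r • y = r • (x * y) := by
  have h (a b : TensorAlgebra K V) : star (a ⊗ₜ (r • b)) = r • star (a ⊗ₜ b) := by
    rw [TensorProduct.tmul_smul, map_smul]
  exact h x y

end StarAlgebra

theorem exists_antipode_of_assoc
    {star : TensorAlgebra K V ⊗[K] TensorAlgebra K V →ₗ[K] TensorAlgebra K V}
    (one_star : ∀ x, star (1 ⊗ₜ x) = x) (star_one : ∀ x, star (x ⊗ₜ 1) = x)
    (star_assoc : ∀ x y z, star (star (x ⊗ₜ y) ⊗ₜ z) = star (x ⊗ₜ star (y ⊗ₜ z))) :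
    ∃ S : TensorAlgebra K V →ₗ[K] TensorAlgebra K V, ∀ x,
      star (S.rTensor _ (Coalgebra.comul (R := K) x)) =
          algebraMap K _ (Coalgebra.counit (R := K) x) ∧
        star (S.lTensor _ (Coalgebra.comul (R := K) x)) =
          algebraMap K _ (Coalgebra.counit (R := K) x) := by
  let _ : Ring (StarAlgebra star) := StarAlgebra.ring one_star star_one star_assoc
  let _ : Algebra K (StarAlgebra star) :=
    Algebra.ofModule StarAlgebra.smul_mul StarAlgebra.mul_smul
  have mul'_map (f g : TensorAlgebra K V →ₗ[K] StarAlgebra star) (t) :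
      LinearMap.mul' K (StarAlgebra star) (TensorProduct.map f g t) =
        star (TensorProduct.map (id f : TensorAlgebra K V →ₗ[K] TensorAlgebra K V)
          (id g : TensorAlgebra K V →ₗ[K] TensorAlgebra K V) t) := by
    induction t with
    | zero => simp only [map_zero]; rfl
    | add s t hs ht => simp only [map_add, hs, ht]; rfl
    | tmul a b => rfl
  obtain ⟨⟨_, S, hS, hS'⟩, rfl⟩ := isUnit_conv_of_map_one (A := StarAlgebra star)
    (f := toConv (LinearMap.id : TensorAlgebra K V →ₗ[K] TensorAlgebra K V)) rfl
  have algebraMap_eq (r : K) :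
      algebraMap K (StarAlgebra star) r = algebraMap K (TensorAlgebra K V) r :=
    (Algebra.algebraMap_eq_smul_one (A := TensorAlgebra K V) r).symm
  refine ⟨S.ofConv, fun x => ⟨?_, ?_⟩⟩
  · have := congrArg (fun f => f x) hS'
    rw [LinearMap.convMul_apply, LinearMap.convOne_apply, mul'_map, algebraMap_eq] at this
    exact this
  · have := congrArg (fun f => f x) hS
    rw [LinearMap.convMul_apply, LinearMap.convOne_apply, mul'_map, algebraMap_eq] at this
    exact this

theorem IsHopfProduct.of_assoc
    {star : TensorAlgebra K V ⊗[K] TensorAlgebra K V →ₗc[K] TensorAlgebra K V}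
    (one_star : ∀ x, star (1 ⊗ₜ x) = x) (star_one : ∀ x, star (x ⊗ₜ 1) = x)
    (star_assoc : ∀ x y z, star (star (x ⊗ₜ y) ⊗ₜ z) = star (x ⊗ₜ star (y ⊗ₜ z))) :
    IsHopfProduct star :=
  ⟨one_star, star_one, star_assoc,
    exists_antipode_of_assoc (star := star.toLinearMap) one_star star_one star_assoc⟩

end Antipode

end TensorCoalgebra

/-! ### `H_WNP` as a tensor coalgebra -/

theorem WNP.hConnected_induction {C : WNP → Prop} (one : C 1)
    (mul : ∀ P Q : WNP, P.HConnected → C Q → C (P * Q)) (P : WNP) : C P := by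
  induction hn : P.card using Nat.strong_induction_on generalizing P with
  | _ n ih =>
    by_cases h : P = 1
    · exact h ▸ one
    · obtain ⟨Q, R, hQ, rfl⟩ := exists_hConnected_mul h
      have hQ_card := mt card_eq_zero.1 (ne_one_of_hConnected hQ)
      exact mul Q R hQ (ih R.card (by rw [← hn, card_mul]; omega) R rfl)

theorem lift_hConnected_injective :
    Function.Injective (FreeMonoid.lift (Subtype.val : {P : WNP // P.HConnected} → WNP)) := by
  intro l
  induction l using FreeMonoid.inductionOn' with
  | one =>
    intro m h
    induction m using FreeMonoid.inductionOn' with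
    | one => rfl
    | of_mul P m _ =>
      rw [map_one, map_mul, FreeMonoid.lift_eval_of] at h
      exact (ne_one_of_hConnected P.2 (mul_eq_one.1 h.symm).1).elim
  | of_mul P l ih =>
    intro m h
    induction m using FreeMonoid.inductionOn' with
    | one =>
      rw [map_one, map_mul, FreeMonoid.lift_eval_of] at h
      exact (ne_one_of_hConnected P.2 (mul_eq_one.1 h).1).elim
    | of_mul Q m _ =>
      rw [map_mul, map_mul, FreeMonoid.lift_eval_of, FreeMonoid.lift_eval_of] at h
      obtain ⟨hPQ, hlm⟩ := hConnected_mul_inj P.2 Q.2 h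
      rw [Subtype.ext hPQ, ih hlm]

theorem lift_hConnected_surjective :
    Function.Surjective (FreeMonoid.lift (Subtype.val : {P : WNP // P.HConnected} → WNP)) := by
  intro P
  induction P using WNP.hConnected_induction with
  | one => exact ⟨1, map_one _⟩
  | mul P Q hP ih =>
    obtain ⟨l, rfl⟩ := ih
    exact ⟨FreeMonoid.of ⟨P, hP⟩ * l, by rw [map_mul, FreeMonoid.lift_eval_of]⟩

/-- The monoid of WN posets is free on the `h`-connected ones. -/
noncomputable def freeMonoidEquiv : FreeMonoid {P : WNP // P.HConnected} ≃* WNP :=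
  MulEquiv.ofBijective (FreeMonoid.lift Subtype.val)
    ⟨lift_hConnected_injective, lift_hConnected_surjective⟩

/-- An `h`-connected poset as a primitive element. -/
noncomputable def primSingle (K : Type*) [Field K] (P : {P : WNP // P.HConnected}) : Prim K :=
  ⟨MonoidAlgebra.single P.1 1, single_mem_prim K P.2⟩

theorem linearIndependent_primSingle : LinearIndependent K (primSingle K) := by
  refine .of_comp (Prim K).subtype ?_
  convert (MonoidAlgebra.basis WNP K).linearIndependent.comp _ Subtype.val_injective
  exact funext fun P => (MonoidAlgebra.basis_apply (k := K) P.1).symm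

theorem span_primSingle : Submodule.span K (Set.range (primSingle K)) = ⊤ := by
  apply Submodule.map_injective_of_injective (Prim K).injective_subtype
  rw [Submodule.map_span, Submodule.map_subtype_top, ← Set.range_comp]
  refine Eq.trans (congrArg _ ?_) prim_eq_span.symm
  ext x
  simp [primSingle, eq_comm]

variable (K) in
/-- The basis of `Prim(H_WNP)` formed by the `h`-connected posets. -/
noncomputable def primBasis : Module.Basis {P : WNP // P.HConnected} K (Prim K) :=
  .mk linearIndependent_primSingle span_primSingle.ge

theorem primBasis_apply (P : {P : WNP // P.HConnected}) : primBasis K P = primSingle K P :=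
  Module.Basis.mk_apply _ _ _

variable (K) in
/-- The identification of `H_WNP` with `T(Prim(H_WNP))`, where the product `P · Q` becomes the
concatenation. -/
noncomputable def tensorEquiv : HWNP K ≃ₐ[K] TensorAlgebra K (Prim K) :=
  (MonoidAlgebra.domCongr K K freeMonoidEquiv.symm).trans <|
    FreeAlgebra.equivMonoidAlgebraFreeMonoid.symm.trans
      (TensorAlgebra.equivFreeAlgebra (primBasis K)).symm

theorem tensorEquiv_single (P : {P : WNP // P.HConnected}) :
    tensorEquiv K (MonoidAlgebra.single P.1 1) = TensorAlgebra.ι K (primSingle K P) := by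
  have hP : freeMonoidEquiv.symm P.1 = FreeMonoid.of P :=
    freeMonoidEquiv.symm_apply_eq.2 (FreeMonoid.lift_eval_of _ _).symm
  have hι : FreeAlgebra.equivMonoidAlgebraFreeMonoid.symm
      (MonoidAlgebra.single (FreeMonoid.of P) (1 : K)) = FreeAlgebra.ι K P := by
    rw [AlgEquiv.symm_apply_eq]
    exact (FreeAlgebra.lift_ι_apply (R := K)
      (fun P => MonoidAlgebra.of K _ (FreeMonoid.of P)) P).symm
  rw [tensorEquiv, AlgEquiv.trans_apply, AlgEquiv.trans_apply, MonoidAlgebra.domCongr_single, hP,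
    hι, TensorAlgebra.equivFreeAlgebra_symm_ι, primBasis_apply]

theorem tensorEquiv_prim (x : Prim K) : tensorEquiv K x = TensorAlgebra.ι K x := by
  have : (tensorEquiv K).toLinearMap ∘ₗ (Prim K).subtype = TensorAlgebra.ι K :=
    (primBasis K).ext fun P => by
      rw [primBasis_apply]
      exact tensorEquiv_single P
  exact LinearMap.congr_fun this x

theorem tensorEquiv_single_mul (P : {P : WNP // P.HConnected}) (Q : WNP) :
    tensorEquiv K (MonoidAlgebra.single (P.1 * Q) 1) =
      TensorAlgebra.ι K (primSingle K P) * tensorEquiv K (MonoidAlgebra.single Q 1) := by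
  rw [← tensorEquiv_single, ← map_mul, MonoidAlgebra.single_mul_single, one_mul]

theorem algebraMapInv_tensorEquiv (x : HWNP K) :
    TensorAlgebra.algebraMapInv (tensorEquiv K x) = x.coeff 1 := by
  classical
  have : TensorAlgebra.algebraMapInv.toLinearMap ∘ₗ (tensorEquiv K).toLinearMap =
      (MonoidAlgebra.basis WNP K).coord 1 := by
    refine HWNP.hom_ext fun P => ?_
    change TensorAlgebra.algebraMapInv (tensorEquiv K (MonoidAlgebra.single P 1)) =
      (MonoidAlgebra.single P 1 : HWNP K).coeff 1
    rw [coeff_single_one]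
    induction P using WNP.hConnected_induction with
    | one => rw [← MonoidAlgebra.one_def, map_one, map_one, if_pos rfl]
    | mul P Q hP _ =>
      rw [tensorEquiv_single_mul ⟨P, hP⟩, map_mul, algebraMapInv_ι, zero_mul,
        if_neg fun h => ne_one_of_hConnected hP (mul_eq_one.1 h.symm).1]
  exact LinearMap.congr_fun this x

open Classical in
theorem primProj_single (P : WNP) : primProj K (MonoidAlgebra.single P 1) =
    if hP : P.HConnected then primSingle K ⟨P, hP⟩ else 0 := by
  rw [primProj, ← MonoidAlgebra.basis_apply, Module.Basis.constr_basis]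
  rfl

theorem primProj_single_mul (P : {P : WNP // P.HConnected}) (Q : WNP) :
    primProj K (MonoidAlgebra.single (P.1 * Q) 1) =
      (MonoidAlgebra.single Q 1 : HWNP K).coeff 1 • primSingle K P := by
  classical
  rw [primProj_single, coeff_single_one]
  by_cases hQ : Q = 1
  · subst hQ
    simp only [mul_one, P.2, dif_pos, if_true, one_smul]
  · rw [dif_neg, if_neg (Ne.symm hQ), zero_smul]
    intro h
    rcases (mul_eq_iff_of_hConnected h).1 rfl with h | h
    · exact hQ h.2
    · exact ne_one_of_hConnected P.2 h.1

theorem ιInv_tensorEquiv (x : HWNP K) : TensorAlgebra.ιInv (tensorEquiv K x) = primProj K x := by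
  classical
  have : TensorAlgebra.ιInv ∘ₗ (tensorEquiv K).toLinearMap = primProj K := by
    refine HWNP.hom_ext fun P => ?_
    change TensorAlgebra.ιInv (tensorEquiv K (MonoidAlgebra.single P 1)) = _
    induction P using WNP.hConnected_induction with
    | one =>
      rw [← MonoidAlgebra.one_def, map_one, ιInv_one, MonoidAlgebra.one_def, primProj_single,
        dif_neg fun h => ne_one_of_hConnected h rfl]
    | mul P Q hP _ =>
      rw [primProj_single_mul ⟨P, hP⟩, tensorEquiv_single_mul ⟨P, hP⟩, ιInv_ι_mul,
        algebraMapInv_tensorEquiv]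
  exact LinearMap.congr_fun this x

open Classical in
theorem factorizations_hConnected_mul {P : WNP} (hP : P.HConnected) (Q : WNP) :
    (finite_factorizations (P * Q)).toFinset = insert (1, P * Q)
      ((finite_factorizations Q).toFinset.image fun p => (P * p.1, p.2)) := by
  ext ⟨A, B⟩
  simp only [Set.Finite.mem_toFinset, Set.mem_ofPred_eq, Finset.mem_insert, Finset.mem_image,
    Prod.mk.injEq, Prod.exists]
  constructor
  · intro h
    obtain ⟨T, ⟨hPA, hB⟩ | ⟨hA, hQ⟩⟩ := exists_mul_or_mul_of_mul_eq_mul h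
    · rcases (mul_eq_iff_of_hConnected hP).1 hPA.symm with ⟨rfl, rfl⟩ | ⟨rfl, rfl⟩
      · exact .inr ⟨1, Q, one_mul Q, mul_one _, by rw [hB, one_mul]⟩
      · exact .inl ⟨rfl, hB⟩
    · exact .inr ⟨T, B, hQ.symm, hA.symm, rfl⟩
  · rintro (⟨rfl, rfl⟩ | ⟨a, b, h, rfl, rfl⟩)
    · rw [one_mul]
    · rw [mul_assoc, h]

theorem comulWNP_single_mul {P : WNP} (hP : P.HConnected) (Q : WNP) :
    comulWNP K (MonoidAlgebra.single (P * Q) 1) =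
      (MonoidAlgebra.single P 1 ⊗ₜ 1) * comulWNP K (MonoidAlgebra.single Q 1) +
        1 ⊗ₜ MonoidAlgebra.single (P * Q) 1 := by
  classical
  rw [comulWNP_single, factorizations_hConnected_mul hP, Finset.sum_insert, Finset.sum_image,
    comulWNP_single, Finset.mul_sum, add_comm]
  · congr 1
    refine Finset.sum_congr rfl fun p _ => ?_
    rw [Algebra.TensorProduct.tmul_mul_tmul, MonoidAlgebra.single_mul_single, one_mul, one_mul]
  · rintro ⟨a, b⟩ _ ⟨c, d⟩ _ h
    simp only [Prod.mk.injEq] at h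
    rw [mul_left_cancel h.1, h.2]
  · simp only [Finset.mem_image, not_exists, Prod.mk.injEq]
    rintro p ⟨-, h, -⟩
    exact ne_one_of_hConnected hP (mul_eq_one.1 h).1

theorem comulWNP_one : comulWNP K (1 : HWNP K) = 1 ⊗ₜ 1 := by
  classical
  refine tensor_ext fun Q R => ?_
  rw [coeff₂_comulWNP, coeff₂_tmul, coeff_one, coeff_one, coeff_one, ite_zero_mul_ite_zero]
  simp [mul_eq_one]

theorem deconc_tensorEquiv (x : HWNP K) :
    deconc K _ (tensorEquiv K x) =
      Algebra.TensorProduct.map (tensorEquiv K).toAlgHom (tensorEquiv K).toAlgHom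
        (comulWNP K x) := by
  have : deconc K (Prim K) ∘ₗ (tensorEquiv K).toLinearMap =
      (Algebra.TensorProduct.map (tensorEquiv K).toAlgHom
        (tensorEquiv K).toAlgHom).toLinearMap ∘ₗ comulWNP K := by
    refine HWNP.hom_ext fun P => ?_
    change deconc K _ (tensorEquiv K (MonoidAlgebra.single P 1)) =
      Algebra.TensorProduct.map (tensorEquiv K).toAlgHom (tensorEquiv K).toAlgHom
        (comulWNP K (MonoidAlgebra.single P 1))
    induction P using WNP.hConnected_induction with
    | one =>
      rw [← MonoidAlgebra.one_def, map_one, deconc_one, comulWNP_one,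
        Algebra.TensorProduct.map_tmul, map_one]
    | mul P Q hP ih =>
      rw [comulWNP_single_mul hP, map_add, map_mul, ← ih, tensorEquiv_single_mul ⟨P, hP⟩,
        deconc_ι_mul, Algebra.TensorProduct.map_tmul, Algebra.TensorProduct.map_tmul, map_one,
        ← tensorEquiv_single, ← map_mul, MonoidAlgebra.single_mul_single, one_mul]
      rfl
  exact LinearMap.congr_fun this x

theorem WNP.idealSum_one {N : Type*} [AddCommMonoid N] (f : WNP → WNP → N) :
    idealSum 1 f = f 1 1 := by
  have : IsEmpty (1 : WNP).rep.carrier :=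
    have := (1 : WNP).rep.finite
    Finite.card_eq_zero_iff.1 card_one
  rw [idealSum, idealSumOn, Finset.sum_eq_single_of_mem ∅ DoublePoset.empty_mem_ideals,
    Set.sdiff_empty, sub_rep_univ, sub_eq_one.2 rfl]
  exact fun J _ hJ => (hJ (Set.eq_empty_of_isEmpty J)).elim

theorem map_map_tensorTensorTensorComm {M N : Type*} [AddCommGroup M] [Module K M]
    [AddCommGroup N] [Module K N] {μ : M ⊗[K] M →ₗ[K] M} {ν : N ⊗[K] N →ₗ[K] N} {f : M →ₗ[K] N}
    (hf : ∀ x y, f (μ (x ⊗ₜ y)) = ν (f x ⊗ₜ f y)) (s t : M ⊗[K] M) :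
    TensorProduct.map f f (TensorProduct.map μ μ
        (TensorProduct.tensorTensorTensorComm K M M M M (s ⊗ₜ t))) =
      TensorProduct.map ν ν (TensorProduct.tensorTensorTensorComm K N N N N
        (TensorProduct.map f f s ⊗ₜ TensorProduct.map f f t)) := by
  induction s with
  | zero => simp
  | add s s' h h' => simp only [TensorProduct.add_tmul, map_add, h, h']
  | tmul x x' =>
    induction t with
    | zero => simp
    | add t t' h h' => simp only [TensorProduct.tmul_add, map_add, h, h']
    | tmul y y' => simp [hf]

variable (K) in
/-- The product `⋆` of `H_WNP` transported to `T(Prim(H_WNP))` along `tensorEquiv`. -/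
noncomputable def starT :
    TensorAlgebra K (Prim K) ⊗[K] TensorAlgebra K (Prim K) →ₗ[K] TensorAlgebra K (Prim K) :=
  (tensorEquiv K).toLinearMap ∘ₗ TensorProduct.lift (starProd K) ∘ₗ
    TensorProduct.map (tensorEquiv K).symm.toLinearMap (tensorEquiv K).symm.toLinearMap

theorem starT_tensorEquiv (x y : HWNP K) :
    starT K (tensorEquiv K x ⊗ₜ tensorEquiv K y) = tensorEquiv K (starProd K x y) := by
  simp [starT]

theorem counit_starT (a b : TensorAlgebra K (Prim K)) :
    Coalgebra.counit (R := K) (starT K (a ⊗ₜ b)) = Coalgebra.counit (R := K) (a ⊗ₜ[K] b) := by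
  obtain ⟨x, rfl⟩ := (tensorEquiv K).surjective a
  obtain ⟨y, rfl⟩ := (tensorEquiv K).surjective b
  rw [starT_tensorEquiv, TensorProduct.counit_tmul]
  simp only [counit_eq, algebraMapInv_tensorEquiv, coeff_starProd, idealSum_one, smul_eq_mul,
    mul_comm]

theorem deconc_starT (a b : TensorAlgebra K (Prim K)) :
    deconc K _ (starT K (a ⊗ₜ b)) = TensorProduct.map (starT K) (starT K)
      (TensorProduct.tensorTensorTensorComm K _ _ _ _ (deconc K _ a ⊗ₜ deconc K _ b)) := by
  obtain ⟨x, rfl⟩ := (tensorEquiv K).surjective a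
  obtain ⟨y, rfl⟩ := (tensorEquiv K).surjective b
  rw [starT_tensorEquiv, deconc_tensorEquiv, deconc_tensorEquiv, deconc_tensorEquiv,
    comulWNP_starProd]
  exact map_map_tensorTensorTensorComm (μ := TensorProduct.lift (starProd K)) (ν := starT K)
    (f := (tensorEquiv K).toLinearMap) (fun x y => (starT_tensorEquiv x y).symm)
    (comulWNP K x) (comulWNP K y)

variable (K) in
/-- The product `⋆` of `T(Prim(H_WNP))` as a morphism of coalgebras. -/
noncomputable def starTc :
    TensorAlgebra K (Prim K) ⊗[K] TensorAlgebra K (Prim K) →ₗc[K] TensorAlgebra K (Prim K) where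
  toLinearMap := starT K
  counit_comp := TensorProduct.ext' counit_starT
  map_comp_comul := TensorProduct.ext' fun a b => (deconc_starT a b).symm

theorem starTc_tensorEquiv (x y : HWNP K) :
    starTc K (tensorEquiv K x ⊗ₜ tensorEquiv K y) = tensorEquiv K (starProd K x y) :=
  starT_tensorEquiv x y

theorem isHopfProduct_starTc : IsHopfProduct (starTc K) := by
  refine .of_assoc (fun a => ?_) (fun a => ?_) fun a b c => ?_
  all_goals obtain ⟨x, rfl⟩ := (tensorEquiv K).surjective a
  · rw [← map_one (tensorEquiv K), starTc_tensorEquiv, one_starProd]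
  · rw [← map_one (tensorEquiv K), starTc_tensorEquiv, starProd_one]
  · obtain ⟨y, rfl⟩ := (tensorEquiv K).surjective b
    obtain ⟨z, rfl⟩ := (tensorEquiv K).surjective c
    simp only [starTc_tensorEquiv, starProd_assoc]

theorem tensorEquiv_primMul (n : ℕ) (x : Fin n → Prim K) :
    tensorEquiv K (primMul K n (PiTensorProduct.tprod K x)) = TensorAlgebra.tprod K _ n x := by
  rw [primMul, PiTensorProduct.lift.tprod, MultilinearMap.compLinearMap_apply,
    MultilinearMap.mkPiAlgebraFin_apply, map_list_prod, List.map_ofFn, TensorAlgebra.tprod_apply]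
  exact congrArg (fun v => (List.ofFn v).prod) (funext fun i => tensorEquiv_prim (x i))

theorem hasBrackets_starTc : HasBrackets (starTc K) (primBrackets K) := by
  intro m n x y
  rw [← tensorEquiv_primMul, ← tensorEquiv_primMul, starTc_tensorEquiv, ιInv_tensorEquiv]
  rfl

theorem isBInfty_primBrackets : IsBInfty (primBrackets K) :=
  ⟨starTc K, isHopfProduct_starTc, hasBrackets_starTc⟩

/-! ### The free `B_∞`-algebra -/

namespace WNP

theorem hConnected_stack {Q R : WNP} (hQ : Q ≠ 1) (hR : R ≠ 1) : (stack Q R).HConnected := by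
  obtain ⟨P, hP, A, hA, rfl, rfl⟩ := exists_isCut_swap Q R
  obtain ⟨a, ha⟩ : A.Nonempty := Set.nonempty_iff_ne_empty.2 (mt sub_eq_one.2 hQ)
  obtain ⟨b, hb⟩ : Aᶜ.Nonempty := Set.nonempty_iff_ne_empty.2 (mt sub_eq_one.2 hR)
  rw [stack_sub_sub_compl hP hA]
  refine (rep_mk P hP).symm.hConnected ⟨⟨a⟩, fun x y => ?_⟩
  by_cases hx : x ∈ A <;> by_cases hy : y ∈ A
  · exact .tail (.single (.inl (hA x hx b hb))) (.inr (hA y hy b hb))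
  · exact .single (.inl (hA x hx y hy))
  · exact .single (.inr (hA y hy x hx))
  · exact .tail (.single (.inr (hA a ha x hx))) (.inl (hA a ha y hy))

/-- `p` is the factorization of `P` as the product of an `h`-connected poset and a nonempty one.
It is unique, and exists if `P` is neither empty nor `h`-connected. -/
def IsMulFactors (p : WNP × WNP) (P : WNP) : Prop :=
  p.1.HConnected ∧ p.2 ≠ 1 ∧ p.1 * p.2 = P

/-- `p` is the decomposition of `P` as the stack of an `r`-connected poset and a nonempty one.
It is unique, and exists if `P` is `h`-connected with at least two points. -/
def IsStackFactors (p : WNP × WNP) (P : WNP) : Prop :=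
  p.1.RConnected ∧ p.2 ≠ 1 ∧ stack p.1 p.2 = P

namespace IsMulFactors

variable {p q : WNP × WNP} {P : WNP}

theorem unique (hp : IsMulFactors p P) (hq : IsMulFactors q P) : p = q := by
  obtain ⟨h₁, h₂⟩ := hConnected_mul_inj hp.1 hq.1 (hp.2.2.trans hq.2.2.symm)
  exact Prod.ext h₁ h₂

theorem hrel_fst_lt (hp : IsMulFactors p P) : hrel p.1 < hrel P := by
  have := hrel_pos hp.2.1
  rw [← hp.2.2, hrel_mul]
  omega

theorem hrel_snd_lt (hp : IsMulFactors p P) : hrel p.2 < hrel P := by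
  have := hrel_pos (ne_one_of_hConnected hp.1)
  rw [← hp.2.2, hrel_mul]
  omega

theorem not_hConnected (hp : IsMulFactors p P) : ¬ P.HConnected := fun h => by
  rcases (mul_eq_iff_of_hConnected h).1 hp.2.2 with h | h
  · exact hp.2.1 h.2
  · exact ne_one_of_hConnected hp.1 h.1

end IsMulFactors

namespace IsStackFactors

variable {p q : WNP × WNP} {P : WNP}

theorem unique (hp : IsStackFactors p P) (hq : IsStackFactors q P) : p = q := by
  obtain ⟨h₁, h₂⟩ := rConnected_stack_inj hp.1 hq.1 (hp.2.2.trans hq.2.2.symm)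
  exact Prod.ext h₁ h₂

theorem hrel_fst_lt (hp : IsStackFactors p P) : hrel p.1 < hrel P := by
  have := hrel_pos hp.2.1
  rw [← hp.2.2, hrel_stack]
  omega

theorem hrel_snd_lt (hp : IsStackFactors p P) : hrel p.2 < hrel P := by
  have := hrel_pos (ne_one_of_rConnected hp.1)
  rw [← hp.2.2, hrel_stack]
  omega

theorem hConnected (hp : IsStackFactors p P) : P.HConnected :=
  hp.2.2 ▸ hConnected_stack (ne_one_of_rConnected hp.1) hp.2.1

theorem ne_point (hp : IsStackFactors p P) : P ≠ point := fun h => by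
  have hcard := congrArg card (hp.2.2.trans h)
  have h₁ := mt card_eq_zero.1 (ne_one_of_rConnected hp.1)
  have h₂ := mt card_eq_zero.1 hp.2.1
  rw [card_stack, card_point] at hcard
  omega

end IsStackFactors

theorem exists_isMulFactors_or_isStackFactors {P : WNP} (h1 : P ≠ 1) (hpoint : P ≠ point) :
    (∃ p, IsMulFactors p P) ∨ ∃ p, IsStackFactors p P := by
  by_cases h : P.HConnected
  · obtain ⟨Q, R, hQ, rfl⟩ := exists_rConnected_stack h1
    refine .inr ⟨(Q, R), hQ, ?_, rfl⟩
    rintro rfl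
    rw [stack_one] at h hpoint
    exact hpoint (eq_point_of_hConnected_of_rConnected h hQ)
  · obtain ⟨Q, R, hQ, rfl⟩ := exists_hConnected_mul h1
    refine .inl ⟨(Q, R), hQ, ?_, rfl⟩
    rintro rfl
    exact h ((mul_one Q).symm ▸ hQ)

open Classical in
/-- The posets other than `stack Q R` that occur in `Q ⋆ R`. They have fewer `≤₁`-related pairs
than `stack Q R`. -/
noncomputable def lowerTerms (Q R : WNP) : Finset WNP :=
  (finite_numIdeals Q R).toFinset.erase (stack Q R)

theorem hrel_lt_of_mem_lowerTerms {Q R S : WNP} (hS : S ∈ lowerTerms Q R) :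
    hrel S < hrel (stack Q R) := by
  classical
  have hS := Finset.mem_erase.1 hS
  exact (eq_stack_or_hrel_lt ((Set.Finite.mem_toFinset _).1 hS.2)).resolve_left hS.1

end WNP

theorem starProd_single_eq_stack_add (Q R : WNP) :
    starProd K (MonoidAlgebra.single Q 1) (MonoidAlgebra.single R 1) =
      MonoidAlgebra.single (stack Q R) 1 +
        ∑ S ∈ lowerTerms Q R, (numIdeals Q R S : K) • MonoidAlgebra.single S 1 := by
  classical
  have hmem : stack Q R ∈ (finite_numIdeals Q R).toFinset := by
    rw [Set.Finite.mem_toFinset, Set.mem_ofPred_eq, numIdeals_stack]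
    exact one_ne_zero
  rw [starProd_single, ← Finset.add_sum_erase _ _ hmem, numIdeals_stack, Nat.cast_one, one_smul]
  rfl

theorem single_stack (Q R : WNP) : (MonoidAlgebra.single (stack Q R) 1 : HWNP K) =
    starProd K (MonoidAlgebra.single Q 1) (MonoidAlgebra.single R 1) -
      ∑ S ∈ lowerTerms Q R, (numIdeals Q R S : K) • MonoidAlgebra.single S 1 :=
  eq_sub_of_add_eq (starProd_single_eq_stack_add Q R).symm

@[elab_as_elim]
theorem HWNP.induction_on_point {C : HWNP K → Prop} (one : C 1)
    (point : C (MonoidAlgebra.single point 1)) (add : ∀ x y, C x → C y → C (x + y))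
    (smul : ∀ (r : K) x, C x → C (r • x)) (mul : ∀ x y, C x → C y → C (x * y))
    (star : ∀ x y, C x → C y → C (starProd K x y)) (x : HWNP K) : C x := by
  have zero : C 0 := zero_smul K (1 : HWNP K) ▸ smul 0 1 one
  have single (P : WNP) : C (MonoidAlgebra.single P 1) := by
    induction hn : hrel P using Nat.strong_induction_on generalizing P with
    | _ n ih =>
      subst hn
      by_cases h1 : P = 1
      · exact h1 ▸ one
      by_cases hpoint : P = WNP.point
      · exact hpoint ▸ point
      rcases exists_isMulFactors_or_isStackFactors h1 hpoint with ⟨⟨Q, R⟩, hQR⟩ | ⟨⟨Q, R⟩, hQR⟩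
      · have := mul _ _ (ih _ hQR.hrel_fst_lt Q rfl) (ih _ hQR.hrel_snd_lt R rfl)
        rwa [MonoidAlgebra.single_mul_single, one_mul, hQR.2.2] at this
      · rw [← hQR.2.2, single_stack, sub_eq_add_neg, ← neg_one_smul K]
        refine add _ _ (star _ _ (ih _ hQR.hrel_fst_lt Q rfl) (ih _ hQR.hrel_snd_lt R rfl))
          (smul _ _ (Finset.sum_induction _ C add zero fun S hS => smul _ _ (ih _ ?_ S rfl)))
        exact hQR.2.2 ▸ hrel_lt_of_mem_lowerTerms hS
  rw [← (MonoidAlgebra.basis WNP K).linearCombination_repr x, Finsupp.linearCombination_apply,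
    Finsupp.sum]
  refine Finset.sum_induction _ C add zero fun P _ => smul _ _ ?_
  rw [MonoidAlgebra.basis_apply]
  exact single P

section Free

variable {A : Type*} [Ring A] [Algebra K A] (s : A →ₗ[K] A →ₗ[K] A) (x : A)

open Classical in
/-- The values on posets of the morphism from `H_WNP` to an algebra with a second product `s` that
sends the one-point poset to `x`, by recursion on `hrel`. -/
noncomputable def freeMap (P : WNP) : A :=
  if h : ∃ p, IsMulFactors p P then freeMap h.choose.1 * freeMap h.choose.2
  else if h : ∃ p, IsStackFactors p P then
    s (freeMap h.choose.1) (freeMap h.choose.2) -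
      ∑ S : lowerTerms h.choose.1 h.choose.2,
        (numIdeals h.choose.1 h.choose.2 S : K) • freeMap S.1
  else if P = point then x
  else 1
termination_by hrel P
decreasing_by
  · exact h.choose_spec.hrel_fst_lt
  · exact h.choose_spec.hrel_snd_lt
  · exact h.choose_spec.hrel_fst_lt
  · exact h.choose_spec.hrel_snd_lt
  · exact (hrel_lt_of_mem_lowerTerms S.2).trans_eq (congrArg hrel h.choose_spec.2.2)

theorem freeMap_point : freeMap s x point = x := by
  rw [freeMap, dif_neg fun ⟨_, h⟩ => h.not_hConnected point_hConnected,
    dif_neg fun ⟨_, h⟩ => h.ne_point rfl, if_pos rfl]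

theorem freeMap_one : freeMap s x 1 = 1 := by
  rw [freeMap, dif_neg fun ⟨_, h⟩ => h.2.1 (mul_eq_one.1 h.2.2).2,
    dif_neg fun ⟨_, h⟩ => ne_one_of_hConnected h.hConnected rfl,
    if_neg (ne_one_of_hConnected point_hConnected).symm]

theorem freeMap_mul_of_hConnected {Q : WNP} (hQ : Q.HConnected) (R : WNP) :
    freeMap s x (Q * R) = freeMap s x Q * freeMap s x R := by
  rcases eq_or_ne R 1 with rfl | hR
  · rw [freeMap_one, mul_one, mul_one]
  have hQR : IsMulFactors (Q, R) (Q * R) := ⟨hQ, hR, rfl⟩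
  have h : ∃ p, IsMulFactors p (Q * R) := ⟨_, hQR⟩
  rw [freeMap, dif_pos h, h.choose_spec.unique hQR]

theorem freeMap_mul (P Q : WNP) : freeMap s x (P * Q) = freeMap s x P * freeMap s x Q := by
  induction P using hConnected_induction with
  | one => rw [freeMap_one, one_mul, one_mul]
  | mul P R hP ih =>
    rw [mul_assoc, freeMap_mul_of_hConnected s x hP, freeMap_mul_of_hConnected s x hP, ih,
      mul_assoc]

theorem freeMap_stack {Q R : WNP} (hQ : Q.RConnected) (hR : R ≠ 1) :
    freeMap s x (stack Q R) = s (freeMap s x Q) (freeMap s x R) -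
      ∑ S ∈ lowerTerms Q R, (numIdeals Q R S : K) • freeMap s x S := by
  have hQR : IsStackFactors (Q, R) (stack Q R) := ⟨hQ, hR, rfl⟩
  have h : ∃ p, IsStackFactors p (stack Q R) := ⟨_, hQR⟩
  rw [freeMap, dif_neg fun ⟨_, h'⟩ => h'.not_hConnected hQR.hConnected, dif_pos h,
    h.choose_spec.unique hQR]
  exact congrArg _ (Finset.sum_coe_sort (lowerTerms Q R)
    fun S => (numIdeals Q R S : K) • freeMap s x S)

/-- The morphism from `H_WNP` to an algebra with a second product `s` that sends the one-point
poset to `x`. -/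
noncomputable def freeHom : HWNP K →ₐ[K] A :=
  MonoidAlgebra.lift K A WNP ⟨⟨freeMap s x, freeMap_one s x⟩, freeMap_mul s x⟩

@[simp] theorem freeHom_single (P : WNP) :
    freeHom s x (MonoidAlgebra.single P 1) = freeMap s x P :=
  (MonoidAlgebra.lift_single _ _ _).trans (one_smul _ _)

variable {s}

theorem freeHom_starProd_of_rConnected (hs1 : ∀ a, s a 1 = a) {Q : WNP} (hQ : Q.RConnected)
    (z : HWNP K) :
    freeHom s x (starProd K (MonoidAlgebra.single Q 1) z) =
      s (freeMap s x Q) (freeHom s x z) := by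
  have : (freeHom s x).toLinearMap ∘ₗ starProd K (MonoidAlgebra.single Q 1) =
      s (freeMap s x Q) ∘ₗ (freeHom s x).toLinearMap := by
    refine HWNP.hom_ext fun R => ?_
    simp only [LinearMap.comp_apply, AlgHom.toLinearMap_apply]
    rcases eq_or_ne R 1 with rfl | hR
    · rw [← MonoidAlgebra.one_def, starProd_one, map_one, hs1, freeHom_single]
    · rw [starProd_single_eq_stack_add, map_add, freeHom_single, freeHom_single,
        freeMap_stack s x hQ hR, map_sum]
      simp only [map_smul, freeHom_single, sub_add_cancel]
  exact LinearMap.congr_fun this z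

theorem freeHom_starProd (hassoc : ∀ a b c, s (s a b) c = s a (s b c)) (h1s : ∀ a, s 1 a = a)
    (hs1 : ∀ a, s a 1 = a) (y z : HWNP K) :
    freeHom s x (starProd K y z) = s (freeHom s x y) (freeHom s x z) := by
  suffices (freeHom s x).toLinearMap ∘ₗ (starProd K).flip z =
      s.flip (freeHom s x z) ∘ₗ (freeHom s x).toLinearMap from LinearMap.congr_fun this y
  refine HWNP.hom_ext fun P => ?_
  change freeHom s x (starProd K (MonoidAlgebra.single P 1) z) =
    s (freeHom s x (MonoidAlgebra.single P 1)) (freeHom s x z)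
  induction hn : hrel P using Nat.strong_induction_on generalizing P z with
  | _ n ih =>
    subst hn
    by_cases h1 : P = 1
    · rw [h1, ← MonoidAlgebra.one_def, one_starProd, map_one, h1s]
    obtain ⟨Q, R, hQ, rfl⟩ := exists_rConnected_stack h1
    by_cases hR : R = 1
    · rw [hR, stack_one, freeHom_starProd_of_rConnected x hs1 hQ, freeHom_single]
    have hQR : IsStackFactors (Q, R) (stack Q R) := ⟨hQ, hR, rfl⟩
    have hlower : ∀ S ∈ lowerTerms Q R, (numIdeals Q R S : K) •
        freeHom s x (starProd K (MonoidAlgebra.single S 1) z) = (numIdeals Q R S : K) •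
          s (freeHom s x (MonoidAlgebra.single S 1)) (freeHom s x z) := fun S hS => by
      rw [ih _ (hrel_lt_of_mem_lowerTerms hS) z S rfl]
    rw [single_stack]
    simp only [map_sub, map_sum, map_smul, LinearMap.sub_apply, LinearMap.sum_apply,
      LinearMap.smul_apply]
    rw [Finset.sum_congr rfl hlower, starProd_assoc, freeHom_starProd_of_rConnected x hs1 hQ,
      ih _ hQR.hrel_snd_lt z R rfl, freeHom_starProd_of_rConnected x hs1 hQ, hassoc]

end Free

theorem comulWNP_mul (x y : HWNP K) :
    comulWNP K (x * y) = (x ⊗ₜ 1) * comulWNP K y + comulWNP K x * (1 ⊗ₜ y) - x ⊗ₜ y := by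
  apply (Algebra.TensorProduct.congr (tensorEquiv K) (tensorEquiv K)).injective
  have h (z : HWNP K) : Algebra.TensorProduct.congr (tensorEquiv K) (tensorEquiv K)
      (comulWNP K z) = deconc K _ (tensorEquiv K z) := (deconc_tensorEquiv z).symm
  simp only [map_sub, map_add, map_mul, h, deconc_mul, Algebra.TensorProduct.congr_apply,
    Algebra.TensorProduct.map_tmul, map_one]
  rfl

variable {B : Type*} [AddCommGroup B] [Module K B]

theorem deconc_star
    (star : TensorAlgebra K B ⊗[K] TensorAlgebra K B →ₗc[K] TensorAlgebra K B)
    (a b : TensorAlgebra K B) :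
    deconc K B (star (a ⊗ₜ b)) = TensorProduct.map star.toLinearMap star.toLinearMap
      (TensorProduct.tensorTensorTensorComm K _ _ _ _ (deconc K B a ⊗ₜ deconc K B b)) := by
  rw [← comul_eq, ← CoalgHomClass.map_comp_comul_apply, TensorProduct.comul_tmul]
  rfl

theorem deconc_of_map_starProd
    {star : TensorAlgebra K B ⊗[K] TensorAlgebra K B →ₗc[K] TensorAlgebra K B}
    {f : HWNP K →ₐ[K] TensorAlgebra K B} (hf : ∀ x y, f (starProd K x y) = star (f x ⊗ₜ f y))
    {b : B} (hb : f (MonoidAlgebra.single point 1) = TensorAlgebra.ι K b) (x : HWNP K) :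
    deconc K B (f x) = Algebra.TensorProduct.map f f (comulWNP K x) := by
  induction x using HWNP.induction_on_point with
  | one => rw [map_one, deconc_one, comulWNP_one, Algebra.TensorProduct.map_tmul, map_one]
  | point =>
    rw [hb, deconc_ι, mem_prim.1 (single_mem_prim K point_hConnected), map_add,
      Algebra.TensorProduct.map_tmul, Algebra.TensorProduct.map_tmul, map_one, hb]
  | add x y hx hy => simp only [map_add, hx, hy]
  | smul r x hx => simp only [map_smul, hx]
  | mul x y hx hy =>
    rw [map_mul, deconc_mul, comulWNP_mul, hx, hy]
    simp only [map_sub, map_add, map_mul, Algebra.TensorProduct.map_tmul, map_one]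
  | star x y hx hy =>
    rw [hf, deconc_star, comulWNP_starProd, hx, hy]
    exact (map_map_tensorTensorTensorComm (μ := TensorProduct.lift (starProd K))
      (ν := star.toLinearMap) (f := f.toLinearMap) hf (comulWNP K x) (comulWNP K y)).symm

theorem mapT_tensorEquiv_eq {f : HWNP K →ₐ[K] TensorAlgebra K B}
    (hf : ∀ x, deconc K B (f x) = Algebra.TensorProduct.map f f (comulWNP K x)) (x : HWNP K) :
    mapT (TensorAlgebra.ιInv ∘ₗ f.toLinearMap ∘ₗ (Prim K).subtype) (tensorEquiv K x) = f x := by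
  have hprim (p : Prim K) : TensorAlgebra.ι K (TensorAlgebra.ιInv (f p)) = f p := by
    apply ι_ιInv_of_primitive
    rw [hf, mem_prim.1 p.2, map_add, Algebra.TensorProduct.map_tmul,
      Algebra.TensorProduct.map_tmul, map_one]
  have : mapT (TensorAlgebra.ιInv ∘ₗ f.toLinearMap ∘ₗ (Prim K).subtype) =
      f.comp (tensorEquiv K).symm.toAlgHom := by
    ext p
    have hp : (tensorEquiv K).symm (TensorAlgebra.ι K p) = p :=
      (tensorEquiv K).symm_apply_eq.2 (tensorEquiv_prim p).symm
    simp [hp, hprim]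
  simp [this]

theorem exists_isBInftyHom {br : Brackets K B} (h : IsBInfty br) (x : B) :
    ∃ φ : Prim K →ₗ[K] B, IsBInftyHom (primBrackets K) br φ ∧ φ (primPoint K) = x := by
  obtain ⟨star, hopf, hstar⟩ := h
  let f : HWNP K →ₐ[K] TensorAlgebra K B :=
    freeHom (TensorProduct.curry star.toLinearMap) (TensorAlgebra.ι K x)
  have hf (y z) : f (starProd K y z) = star (f y ⊗ₜ f z) :=
    freeHom_starProd _ hopf.star_assoc hopf.one_star hopf.star_one y z
  have hpoint : f (MonoidAlgebra.single point 1) = TensorAlgebra.ι K x :=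
    (freeHom_single _ _ _).trans (freeMap_point _ _)
  have hmapT := mapT_tensorEquiv_eq (deconc_of_map_starProd hf hpoint)
  refine ⟨TensorAlgebra.ιInv ∘ₗ f.toLinearMap ∘ₗ (Prim K).subtype,
    isBInftyHom_of_mapT_star hasBrackets_starTc hstar fun a b => ?_,
    (congrArg TensorAlgebra.ιInv hpoint).trans (ιInv_ι x)⟩
  obtain ⟨y, rfl⟩ := (tensorEquiv K).surjective a
  obtain ⟨z, rfl⟩ := (tensorEquiv K).surjective b
  rw [starTc_tensorEquiv, hmapT, hmapT, hmapT, hf]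

theorem isBInftyHom_unique {br : Brackets K B} (h : IsBInfty br) {φ ψ : Prim K →ₗ[K] B}
    (hφ : IsBInftyHom (primBrackets K) br φ) (hψ : IsBInftyHom (primBrackets K) br ψ)
    (hpoint : φ (primPoint K) = ψ (primPoint K)) : φ = ψ := by
  obtain ⟨star, hopf, hstar⟩ := h
  have hmapT (x : HWNP K) : mapT φ (tensorEquiv K x) = mapT ψ (tensorEquiv K x) := by
    induction x using HWNP.induction_on_point with
    | one => simp only [map_one]
    | point =>
      have : tensorEquiv K (MonoidAlgebra.single point 1) = TensorAlgebra.ι K (primPoint K) :=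
        tensorEquiv_prim (primPoint K)
      rw [this, mapT_ι, mapT_ι, hpoint]
    | add x y hx hy => simp only [map_add, hx, hy]
    | smul r x hx => simp only [map_smul, hx]
    | mul x y hx hy => simp only [map_mul, hx, hy]
    | star x y hx hy =>
      rw [← starTc_tensorEquiv, hφ.mapT_star isHopfProduct_starTc hasBrackets_starTc hopf hstar,
        hψ.mapT_star isHopfProduct_starTc hasBrackets_starTc hopf hstar, hx, hy]
  ext p
  have hp := hmapT p
  rw [tensorEquiv_prim, mapT_ι, mapT_ι] at hp
  exact (TensorAlgebra.ι_inj K _ _).1 hp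

end BInf

theorem mainTheorem6 (K : Type*) [Field K] :
    BInf.Prim K =
        Submodule.span K {x | ∃ P : BInf.WNP, P.HConnected ∧ x = MonoidAlgebra.single P 1} ∧
      BInf.IsBInfty (BInf.primBrackets K) ∧
      ∀ (B : Type*) [AddCommGroup B] [Module K B] (br : BInf.Brackets K B),
        BInf.IsBInfty br → ∀ x : B,
          ∃! φ : BInf.Prim K →ₗ[K] B,
            BInf.IsBInftyHom (BInf.primBrackets K) br φ ∧ φ (BInf.primPoint K) = x := by
  refine ⟨BInf.prim_eq_span, BInf.isBInfty_primBrackets, fun B _ _ br h x => ?_⟩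
  obtain ⟨φ, hφ, hx⟩ := BInf.exists_isBInftyHom h x
  exact ⟨φ, ⟨hφ, hx⟩, fun ψ hψ => BInf.isBInftyHom_unique h hψ.1 hφ (hψ.2.trans hx.symm)⟩
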